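/- **Theorem.** Consider a random wireless network of $n$ nodes placed independently and uniformly at random in the unit square. Every node is the source of a multicast session whose $m$ destinations are $m$ distinct other nodes, chosen uniformly at random, independently over the sources and independently of the positions. Time is slotted; in each slot an active link $i\to j$ carries one packet (one bit), and a node may send different packets to several nodes (MPT) and receive different packets from several nodes (MPR) in the same slot. With common range $T(n)$ and guard parameter $\Delta>0$, a link $i\to j$ may be active in a slot only if $|X_i-X_j|\le T(n)$, node $j$ does not transmit in that slot (half-duplex), and every node $k$ transmitting in that slot satisfies $|X_k-X_j|\le T(n)$ or $|X_k-X_j|\ge(1+\Delta)T(n)$. Nodes store and forward packets without network coding. A per-node throughput $\lambda$ is *feasible* if for some such schedule and some period $\tau$, in every time interval $[i\tau,(i+1)\tau)$, $i\ge 0$, for every source the delivery of at least $\lambda\tau$ of its packets to all $m$ of its destinations is completed. There is a constant $K>0$ such that for all $\Delta>0$ and $B>0$ there is a constant $c>0$, depending only on $\Delta$ and $B$, with the following property. For every fixed number $m\ge1$ of destinations, and every range $T(n)$ that satisfies, for all large $n$, $$K\sqrt{\frac{\log n}{n}}\;\le\;T(n)\;\le\;B\,\frac{\log\log n}{\log n},$$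 the per-node multicast throughput $c\,\dfrac{n\,T^3(n)}{\sqrt m}$ is feasible with probability tending to $1$ as $n\to\infty$. That is, $C_m(n)=\Omega\big(nT^3(n)/\sqrt m\big)$ w.h.p. -/

import Mathlib

open MeasureTheory ProbabilityTheory Filter Topology

noncomputable section

namespace Multicast

/-- The Euclidean plane, in which the nodes live. -/
abbrev Plane : Type := EuclideanSpace ℝ (Fin 2)

/-- The network area, a square of side one. -/
def unitSquare : Set Plane := {x | ∀ i, x i ∈ Set.Icc (0 : ℝ) 1}

/-- A choice of `m` destinations for each of the `n` nodes: `D s k` is the `k`-th destination of the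
multicast session whose source is `s`. -/
abbrev Destinations (n m : ℕ) : Type := Fin n → Fin m → Fin n

/-- The `m` destinations of a source are distinct, and different from the source. -/
def admissible (n m : ℕ) : Set (Destinations n m) :=
  {D | ∀ s, Function.Injective (D s) ∧ ∀ k, D s k ≠ s}

/-- The law of the random network: the `n` positions are independent and uniform on the unit square;
independently of them, the destinations are uniform on the admissible choices, that is, each source
independently picks `m` distinct other nodes uniformly at random. -/
def networkLaw (n m : ℕ) : Measure ((Fin n → Plane) × Destinations n m) :=
  (Measure.pi fun _ : Fin n => (volume : Measure Plane).restrict unitSquare).prod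
    (uniformOn (admissible n m))

/-- A packet (of one bit): its source and its serial number in the stream of that source. -/
abbrev Packet (n : ℕ) : Type := Fin n × ℕ

/-- What happens in one time slot: `A i j` is the packet sent on the link from `i` to `j`, and `none`
if the link is idle. A node may send different packets to several nodes in one slot (multi-packet
transmission) and receive different packets from several nodes (multi-packet reception); each link
carries at most one packet per slot. -/
abbrev SlotAction (n : ℕ) : Type := Fin n → Fin n → Option (Packet n)

/-- Node `i` transmits in the slot. -/
def Transmits {n : ℕ} (A : SlotAction n) (i : Fin n) : Prop := ∃ j, A i j ≠ none

/-- The protocol model with multi-packet transmission and reception, common range `r` and guard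
parameter `Δ`. On every active link `i → j`, the receiver lies within range `r` of the transmitter and
does not itself transmit (half-duplex), and every node that transmits in the same slot is either in
the reception disk of radius `r` of `j`, so that `j` resolves it, or at distance at
least `(1 + Δ) r` from `j`, so that it does not interfere. -/
def ProtocolModel {n : ℕ} (X : Fin n → Plane) (r Δ : ℝ) (A : SlotAction n) : Prop :=
  ∀ i j, A i j ≠ none →
    dist (X i) (X j) ≤ r ∧ ¬ Transmits A j ∧
      ∀ k, Transmits A k → dist (X k) (X j) ≤ r ∨ (1 + Δ) * r ≤ dist (X k) (X j)

/-- The packets that node `v` has in its buffer at the beginning of slot `t`, when the network is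
operated by the schedule `S` : its own packets, and all those it received in earlier slots. -/
def Holds {n : ℕ} (S : ℕ → SlotAction n) (v : Fin n) (p : Packet n) (t : ℕ) : Prop :=
  p.1 = v ∨ ∃ t' < t, ∃ u, S t' u v = some p

/-- A multi-hop store-and-forward schedule: the protocol model holds in every slot, and a node only
sends packets that it holds. -/
def IsSchedule {n : ℕ} (X : Fin n → Plane) (r Δ : ℝ) (S : ℕ → SlotAction n) : Prop :=
  (∀ t, ProtocolModel X r Δ (S t)) ∧ ∀ t u v p, S t u v = some p → Holds S u p t

/-- At the beginning of slot `t`, the `q`-th packet of source `s` has reached all destinations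
of `s`. -/
def Completed {n m : ℕ} (S : ℕ → SlotAction n) (D : Destinations n m) (s : Fin n) (q t : ℕ) : Prop :=
  ∀ k, Holds S (D s k) (s, q) t

/-- The per-node multicast throughput `lam` (in packets per slot) is feasible: for some schedule and
some period `τ`, in every interval `[i τ, (i + 1) τ)` the multicast of at least `lam * τ` packets of
every source to all its `m` destinations is completed. -/
def Feasible {n m : ℕ} (X : Fin n → Plane) (D : Destinations n m) (r Δ lam : ℝ) : Prop :=
  ∃ S : ℕ → SlotAction n, IsSchedule X r Δ S ∧ ∃ τ : ℕ, 0 < τ ∧ ∀ (i : ℕ) (s : Fin n),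
    ∃ F : Finset ℕ, lam * τ ≤ F.card ∧
      ∀ q ∈ F, ¬ Completed S D s q (i * τ) ∧ Completed S D s q ((i + 1) * τ)

end Multicast

end

open MeasureTheory ProbabilityTheory Filter Topology

noncomputable section

namespace Multicast

/-! Write r = T(n) and cut the square into g × g cells of side between r/4 and r/3. A cell holds
about μ = n/g² nodes, and P ≥ μ/4 of them serve as relays. In a slot given to one colour class of
cells, multi-packet transmission and reception let all P² links from the relays of a cell to those
of an adjacent cell be active together. A batch of P² packets is indexed by pairs (a, b) and kept at
relay a in cells of even parity and at relay b in cells of odd parity; crossing a cell border then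
uses each of the P² links exactly once.

A session is routed along a comb: a vertical spine next to its source, horizontal teeth h rows
apart, and towards each destination a vertical branch of fewer than h cells. A cell lies on about (g
+ g²/h + mh)μ combs. The choice h ≈ g/√m balances teeth and branches and gives order √m·g·μ packets
per link and batch. The colouring costs a constant factor, so the rate is of order μ²/(√m·g·μ) =
n/(g³√m), that is, nr³/√m.

At the last hop, a link into a node that is a destination of L sessions carries LP packets. As for
balls in bins, L = O(log n / log log n) with high probability, and the upper bound on T(n) makes
this O(g), which is affordable. The lower bound on T(n) makes μ at least 16 log n, so that Chernoff
bounds survive the union over cells.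

`feasible_of_jobs` turns link loads into a schedule, `feasible_of_grid` bounds the loads of the
routing, `ncard_combVisits_le` counts the combs through a cell, `networkLaw_regular_compl_le`
supplies the probability, and `feasible_of_regular` collects the constants. -/

/-! ### Pipelined time-division schedules -/

/-- Store-and-forward transfers with delays, at most `J` per link, can be carried out in a pipelined
time-division schedule: the transfer `Job s q u v d` moves, in each frame `f ≥ d`, the packet number
`q` of batch `f - d` of source `s` from `u` to `v`. -/
theorem feasible_of_jobs {n m : ℕ} (hm : 0 < m) (X : Fin n → Plane) (D : Destinations n m)
    (hD : D ∈ admissible n m) {r Δ lam : ℝ} {Cn J H Q : ℕ} (hCn : 0 < Cn) (hJ : 0 < J)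
    (col : Fin n → ℕ) (hcol : ∀ i, col i < Cn)
    (Job : Fin n → Fin Q → Fin n → Fin n → ℕ → Prop)
    (rank : Fin n → Fin n → Fin n × Fin Q × ℕ → ℕ)
    (hrank : ∀ s q u v d, Job s q u v d → rank u v (s, q, d) < J)
    (hinj : ∀ u v s q d s' q' d', Job s q u v d → Job s' q' u v d' →
      rank u v (s, q, d) = rank u v (s', q', d') → s = s' ∧ q = q' ∧ d = d')
    (hair : ∀ s q u v d, Job s q u v d → dist (X u) (X v) ≤ r ∧ col v ≠ col u ∧
      ∀ k, col k = col u → dist (X k) (X v) ≤ r ∨ (1 + Δ) * r ≤ dist (X k) (X v))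
    (hcausal : ∀ s q u v d, Job s q u v d → s = u ∨ ∃ u' d', d' < d ∧ Job s q u' u d')
    (hdeliver : ∀ s q k, ∃ u d, Job s q u (D s k) d)
    (hdelay : ∀ s q u v d, Job s q u v d → d ≤ H)
    (hlam : lam * (2 * (Cn * J)) ≤ Q) :
    Feasible X D r Δ lam := by
  classical
  set Fl := Cn * J with hFl
  have hFl0 : 0 < Fl := Nat.mul_pos hCn hJ
  -- A slot number is read in mixed radix: the frame, then the colour allowed to transmit, then the
  -- rank of the transfer served on each link.
  let R : ℕ → Fin n → Fin n → Packet n → Prop := fun t u v p =>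
    ∃ s q d, Job s q u v d ∧ rank u v (s, q, d) = (t % Fl) % J ∧ col u = (t % Fl) / J ∧
      d ≤ t / Fl ∧ p = (s, (t / Fl - d) * Q + q)
  have Runi : ∀ t u v p p', R t u v p → R t u v p' → p = p' := by
    rintro t u v p p' ⟨s, q, d, h1, h2, -, -, rfl⟩ ⟨s', q', d', h1', h2', -, -, rfl⟩
    obtain ⟨rfl, rfl, rfl⟩ := hinj _ _ _ _ _ _ _ _ h1 h1' (h2.trans h2'.symm)
    rfl
  let S : ℕ → SlotAction n := fun t u v =>
    if h : ∃ p, R t u v p then some h.choose else none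
  have hS : ∀ t u v p, S t u v = some p ↔ R t u v p := by
    intro t u v p
    by_cases h : ∃ p, R t u v p
    · simp only [S, dif_pos h, Option.some.injEq]
      constructor
      · rintro rfl; exact h.choose_spec
      · intro hp; exact Runi _ _ _ _ _ h.choose_spec hp
    · simp only [S, dif_neg h, reduceCtorEq, false_iff]
      exact fun hp => h ⟨p, hp⟩
  have hne : ∀ t u v, S t u v ≠ none → ∃ p, R t u v p := by
    intro t u v h
    obtain ⟨p, hp⟩ := Option.ne_none_iff_exists'.1 h
    exact ⟨p, (hS _ _ _ _).1 hp⟩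
  have htr : ∀ t u, Transmits (S t) u → col u = (t % Fl) / J := by
    rintro t u ⟨v, hv⟩
    obtain ⟨p, s, q, d, -, -, h, -⟩ := hne _ _ _ hv
    exact h
  have hdo : ∀ s q u v d b, Job s q u v d →
      ∃ t, (b + d) * Fl ≤ t ∧ t < (b + d + 1) * Fl ∧ S t u v = some (s, b * Q + q) := by
    intro s q u v d b hj
    have hr := hrank _ _ _ _ _ hj
    have hc := hcol u
    set ρ := rank u v (s, q, d) with hρ
    have hlt : col u * J + ρ < Fl := by
      calc col u * J + ρ < col u * J + J := by omega
        _ = (col u + 1) * J := by ring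
        _ ≤ Cn * J := Nat.mul_le_mul_right _ hc
    have hmod : ((b + d) * Fl + (col u * J + ρ)) % Fl = col u * J + ρ := by
      rw [Nat.mul_add_mod_self_right, Nat.mod_eq_of_lt hlt]
    have hdiv : ((b + d) * Fl + (col u * J + ρ)) / Fl = b + d := by
      rw [mul_comm, Nat.mul_add_div hFl0, Nat.div_eq_of_lt hlt, add_zero]
    refine ⟨(b + d) * Fl + (col u * J + ρ), by omega, ?_, ?_⟩
    · rw [add_mul (b + d) 1]; omega
    · rw [hS]
      refine ⟨s, q, d, hj, ?_, ?_, ?_, ?_⟩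
      · rw [hmod, Nat.mul_add_mod_self_right, Nat.mod_eq_of_lt hr]
      · rw [hmod, mul_comm (col u), Nat.mul_add_div hJ, Nat.div_eq_of_lt hr, add_zero]
      · rw [hdiv]; omega
      · rw [hdiv]; simp
  refine ⟨S, ⟨?_, ?_⟩, 2 * (H + 1) * Fl, by positivity, ?_⟩
  · intro t i j hij
    obtain ⟨p, s, q, d, hj, -, hc, -⟩ := hne _ _ _ hij
    obtain ⟨h1, h2, h3⟩ := hair _ _ _ _ _ hj
    refine ⟨h1, fun h => h2 ((htr _ _ h).trans hc.symm), fun k hk => h3 k ((htr _ _ hk).trans hc.symm)⟩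
  · intro t u v p hp
    obtain ⟨s, q, d, hj, -, -, hd, rfl⟩ := (hS _ _ _ _).1 hp
    rcases hcausal _ _ _ _ _ hj with h | ⟨u', d', hd', hj'⟩
    · exact Or.inl h
    · obtain ⟨t', -, ht', hs⟩ := hdo _ _ _ _ _ (t / Fl - d) hj'
      refine Or.inr ⟨t', ?_, u', hs⟩
      calc t' < (t / Fl - d + d' + 1) * Fl := ht'
        _ ≤ (t / Fl) * Fl := Nat.mul_le_mul_right _ (by omega)
        _ ≤ t := Nat.div_mul_le_self _ _
  · intro i s
    -- Only the batches started in the first H + 1 frames of the period are counted. None of their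
    -- packets moves before the period begins, and a delay of at most H lets all of them finish
    -- before it ends. The uncounted half is the factor 2 in `hlam`.
    refine ⟨Finset.Ico (i * (2 * (H + 1)) * Q) ((i * (2 * (H + 1)) + (H + 1)) * Q), ?_, ?_⟩
    · rw [Nat.card_Ico, add_mul, Nat.add_sub_cancel_left]
      push_cast
      have : lam * (2 * (Cn * J)) * (H + 1) ≤ Q * (H + 1) := by gcongr
      rw [hFl]; push_cast
      nlinarith
    · intro q hq
      rw [Finset.mem_Ico] at hq
      have hQ : 0 < Q := by
        rcases Nat.eq_zero_or_pos Q with h | h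
        · subst h; omega
        · exact h
      have hqeq : q = (q / Q) * Q + (⟨q % Q, Nat.mod_lt _ hQ⟩ : Fin Q) := by
        simp [Nat.div_add_mod']
      have hb1 : i * (2 * (H + 1)) ≤ q / Q := (Nat.le_div_iff_mul_le hQ).2 hq.1
      have hb2 : q / Q < i * (2 * (H + 1)) + (H + 1) := (Nat.div_lt_iff_lt_mul hQ).2 hq.2
      constructor
      · intro hc
        rcases hc ⟨0, hm⟩ with h | ⟨t', ht', u, hu⟩
        · exact (hD s).2 _ h.symm
        · obtain ⟨s', q', d, -, -, -, hd, hp⟩ := (hS _ _ _ _).1 hu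
          have hp2 : q = (t' / Fl - d) * Q + q' := congrArg Prod.snd hp
          have : q / Q = t' / Fl - d := by
            rw [hp2, mul_comm, Nat.mul_add_div hQ, Nat.div_eq_of_lt q'.2, add_zero]
          have hf : t' / Fl < i * (2 * (H + 1)) := by
            rw [Nat.div_lt_iff_lt_mul hFl0, mul_assoc]; exact ht'
          omega
      · intro k
        obtain ⟨u, d, hj⟩ := hdeliver s ⟨q % Q, Nat.mod_lt _ hQ⟩ k
        obtain ⟨t', -, ht', hs⟩ := hdo _ _ _ _ _ (q / Q) hj
        have hdH := hdelay _ _ _ _ _ hj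
        refine Or.inr ⟨t', ht'.trans_le ?_, u, by rw [hs]; simp [Nat.div_add_mod']⟩
        rw [show (i + 1) * (2 * (H + 1) * Fl) = (i + 1) * (2 * (H + 1)) * Fl by ring]
        refine Nat.mul_le_mul_right _ ?_
        calc q / Q + d + 1 ≤ i * (2 * (H + 1)) + (H + 1) + (H + 1) := by omega
          _ = (i + 1) * (2 * (H + 1)) := by ring

/-! ### Comb-shaped routing trees on the grid -/

/-- Cells of the square grid that share a side. -/
def CellAdj (a b : ℕ × ℕ) : Prop :=
  a.1 = b.1 ∧ (a.2 + 1 = b.2 ∨ b.2 + 1 = a.2) ∨ a.2 = b.2 ∧ (a.1 + 1 = b.1 ∨ b.1 + 1 = a.1)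

/-- A neighbour of a cell in its row. -/
def besideCell (c : ℕ × ℕ) : ℕ × ℕ := (if c.1 = 0 then 1 else c.1 - 1, c.2)

/-- One step from `b` in the direction of `a`. -/
def stepToward (a b : ℕ) : ℕ := if b < a then b + 1 else b - 1

/-- The predecessor of the cell `c` in the comb with root `o` whose teeth are `h` rows apart. -/
def combParent (h : ℕ) (o c : ℕ × ℕ) : ℕ × ℕ :=
  if h ∣ Nat.dist c.2 o.2 ∧ c.1 ≠ o.1 then (stepToward o.1 c.1, c.2) else (c.1, stepToward o.2 c.2)

/-- The number of steps from the root `o` of the comb to the cell `c`. -/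
def combDepth (o c : ℕ × ℕ) : ℕ := Nat.dist c.1 o.1 + Nat.dist c.2 o.2

/-- The rows `y` and `y'` branch off from the same tooth of the comb rooted in row `o`. -/
def SameBlock (h o y y' : ℕ) : Prop :=
  Nat.dist y o / h = Nat.dist y' o / h ∧ (o ≤ y ∧ o ≤ y' ∨ y ≤ o ∧ y' ≤ o)

/-- The cell `c` lies on the spine, on a tooth, or on the branch to a target. -/
def CombVisits {ι : Type*} (h : ℕ) (o : ℕ × ℕ) (tgt : ι → ℕ × ℕ) (c : ℕ × ℕ) : Prop :=
  c.1 = o.1 ∨ h ∣ Nat.dist c.2 o.2 ∨ ∃ k, c.1 = (tgt k).1 ∧ SameBlock h o.2 c.2 (tgt k).2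

theorem besideCell_adj (c : ℕ × ℕ) : CellAdj c (besideCell c) := by
  unfold CellAdj besideCell
  split_ifs <;> simp <;> omega

theorem CellAdj.symm {a b : ℕ × ℕ} (h : CellAdj a b) : CellAdj b a := by
  unfold CellAdj at *
  omega

theorem combVisits_target {ι : Type*} (h : ℕ) (o : ℕ × ℕ) (tgt : ι → ℕ × ℕ) (k : ι) :
    CombVisits h o tgt (tgt k) :=
  Or.inr (Or.inr ⟨k, rfl, rfl, by omega⟩)

/-- Equal quotients by h on the same side of the root row: a branch is shorter than h. -/
theorem SameBlock.lt {h o y y' : ℕ} (hh : 0 < h) (hb : SameBlock h o y y') :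
    y < y' + h ∧ y' < y + h := by
  obtain ⟨h1, h2⟩ := hb
  have e1 := Nat.div_add_mod (Nat.dist y o) h
  have e2 := Nat.div_add_mod (Nat.dist y' o) h
  have l1 := Nat.mod_lt (Nat.dist y o) hh
  have l2 := Nat.mod_lt (Nat.dist y' o) hh
  rw [h1] at e1
  simp only [Nat.dist] at *
  omega

theorem stepToward_adj {a b : ℕ} (h : b ≠ a) :
    stepToward a b + 1 = b ∨ b + 1 = stepToward a b := by
  unfold stepToward
  split_ifs
  · exact Or.inr rfl
  · omega

/-- Iterating the predecessor map leads to the root without leaving the comb or the grid, and the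
depth, which becomes the delay, drops by one at each step. -/
theorem combParent_spec {ι : Type*} {g h : ℕ} {o c : ℕ × ℕ} {tgt : ι → ℕ × ℕ}
    (hv : CombVisits h o tgt c) (hne : c ≠ o) (ho : o.1 < g ∧ o.2 < g) (hc : c.1 < g ∧ c.2 < g) :
    CombVisits h o tgt (combParent h o c) ∧ CellAdj (combParent h o c) c ∧
      combDepth o (combParent h o c) + 1 = combDepth o c ∧
      (combParent h o c).1 < g ∧ (combParent h o c).2 < g := by
  obtain ⟨x, y⟩ := c
  obtain ⟨x0, y0⟩ := o
  have hne' : ¬ (x = x0 ∧ y = y0) := fun hh => hne (Prod.ext hh.1 hh.2)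
  simp only at ho hc
  by_cases hH : h ∣ Nat.dist y y0 ∧ x ≠ x0
  · have hp : combParent h (x0, y0) (x, y) = (stepToward x0 x, y) := if_pos hH
    rw [hp]
    refine ⟨Or.inr (Or.inl hH.1), Or.inr ⟨rfl, stepToward_adj hH.2⟩, ?_, ?_, hc.2⟩ <;>
      simp only [combDepth, stepToward, Nat.dist] <;> split_ifs <;> omega
  · have hp : combParent h (x0, y0) (x, y) = (x, stepToward y0 y) := if_neg hH
    have hy : y ≠ y0 := by
      rintro rfl
      exact hH ⟨by simp [Nat.dist_self], fun h' => hne' ⟨h', rfl⟩⟩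
    rw [hp]
    have hd : Nat.dist y y0 = Nat.dist (stepToward y0 y) y0 + 1 := by
      simp only [stepToward, Nat.dist]; split_ifs <;> omega
    refine ⟨?_, ?_, ?_, ?_, ?_⟩
    · by_cases hx : x = x0
      · exact Or.inl hx
      have hnd : ¬ h ∣ Nat.dist y y0 := fun h' => hH ⟨h', hx⟩
      rcases hv with h' | h' | ⟨k, h1, h2, h3⟩
      · exact absurd h' hx
      · exact absurd h' hnd
      · refine Or.inr (Or.inr ⟨k, h1, ?_, ?_⟩)
        -- Off the teeth, the distance to the root row is not a multiple of h, so lowering it by one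
        -- keeps the quotient and hence the block.
        · rw [← h2]
          simp only
          rw [hd] at hnd ⊢
          exact (Nat.succ_div_of_not_dvd hnd).symm
        · simp only [stepToward] at *
          split_ifs <;> omega
    · exact Or.inl ⟨rfl, stepToward_adj hy⟩
    · simp only [combDepth]; omega
    · exact hc.1
    · simp only [stepToward]; split_ifs <;> omega

/-! ### Relays on a checkerboard and the load of a link -/

theorem exists_rank {α : Type*} (F : Finset α) :
    ∃ rank : α → ℕ, (∀ x ∈ F, rank x < F.card) ∧ Set.InjOn rank F := by
  classical
  refine ⟨fun x => if h : x ∈ F then F.equivFin ⟨x, h⟩ else 0, fun x hx => ?_, fun x hx y hy h => ?_⟩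
  · simp [hx]
  · have hx' : x ∈ F := hx
    have hy' : y ∈ F := hy
    simp only [hx', hy', dif_pos] at h
    exact congrArg Subtype.val (F.equivFin.injective (Fin.ext h))

/-- The packet `q` of a batch is kept at this relay of the cell `c`. -/
def relayIndex {P : ℕ} (c : ℕ × ℕ) (q : Fin P × Fin P) : Fin P :=
  if (c.1 + c.2) % 2 = 0 then q.1 else q.2

/-- The component of `q` that does not determine the relay in the cell `c`. -/
def otherIndex {P : ℕ} (c : ℕ × ℕ) (q : Fin P × Fin P) : Fin P :=
  if (c.1 + c.2) % 2 = 0 then q.2 else q.1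

theorem eq_of_relayIndex_otherIndex {P : ℕ} {c : ℕ × ℕ} {q q' : Fin P × Fin P}
    (h : relayIndex c q = relayIndex c q') (h' : otherIndex c q = otherIndex c q') : q = q' := by
  unfold relayIndex otherIndex at *
  split_ifs at * <;> exact Prod.ext (by assumption) (by assumption)

/-- Adjacent cells have opposite parities, so the two ends of a link reveal both coordinates of the
packet. A session therefore puts only one packet per batch on each relay link. -/
theorem eq_of_relayIndex_adj {P : ℕ} {c c' : ℕ × ℕ} (ha : CellAdj c c') {q q' : Fin P × Fin P}
    (h : relayIndex c q = relayIndex c q') (h' : relayIndex c' q = relayIndex c' q') : q = q' := by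
  have : otherIndex c q = relayIndex c' q ∧ otherIndex c q' = relayIndex c' q' := by
    unfold CellAdj at ha
    unfold relayIndex otherIndex
    constructor <;> split_ifs <;> first | rfl | omega
  exact eq_of_relayIndex_otherIndex h (by rw [this.1, this.2, h'])

/-- Comb routing over a grid of cells, each with `P` relay nodes: it suffices to bound the number of
sessions that visit a cell, and the number of sessions with a given destination. -/
theorem feasible_of_grid {n m : ℕ} (hm : 0 < m) (X : Fin n → Plane) (D : Destinations n m)
    (hD : D ∈ admissible n m) {r Δ lam : ℝ} {Cn g h P W L : ℕ} (hCn : 0 < Cn) (hP : 0 < P)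
    (hg : 1 < g) (cl : Fin n → ℕ × ℕ) (hcl : ∀ v, (cl v).1 < g ∧ (cl v).2 < g)
    (rel : ℕ × ℕ → Fin P → Fin n)
    (hrel : ∀ c : ℕ × ℕ, c.1 < g ∧ c.2 < g → Function.Injective (rel c) ∧ ∀ a, cl (rel c a) = c)
    (col : Fin n → ℕ) (hcol : ∀ i, col i < Cn)
    (hair : ∀ u v, CellAdj (cl u) (cl v) → dist (X u) (X v) ≤ r ∧ col v ≠ col u ∧
      ∀ k, col k = col u → dist (X k) (X v) ≤ r ∨ (1 + Δ) * r ≤ dist (X k) (X v))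
    (hW : ∀ c : ℕ × ℕ, c.1 < g ∧ c.2 < g → {s : Fin n | CombVisits h (besideCell (cl s))
      (fun k => besideCell (cl (D s k))) c}.ncard ≤ W)
    (hL : ∀ v, {s : Fin n | ∃ k, D s k = v}.ncard ≤ L)
    (hlam : lam * (2 * (Cn * (P + W + L * P))) ≤ P * P) :
    Feasible X D r Δ lam := by
  classical
  -- Routes start and end in a cell beside that of the node itself: its own cell has the same
  -- colour, and half-duplex would forbid transfers inside it.
  set home : Fin n → ℕ × ℕ := fun s => besideCell (cl s) with hhome
  have hadj : ∀ s, CellAdj (cl s) (home s) := fun s => besideCell_adj _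
  have hhg : ∀ s, (home s).1 < g ∧ (home s).2 < g := by
    intro s
    have := hcl s
    simp only [hhome, besideCell]
    split_ifs <;> omega
  set V : Fin n → ℕ × ℕ → Prop := fun s c =>
    CombVisits h (home s) (fun k => home (D s k)) c with hV
  let e : Fin (P * P) → Fin P × Fin P := finProdFinEquiv.symm
  have he : Function.Injective e := finProdFinEquiv.symm.injective
  let par : Fin n → ℕ × ℕ → ℕ × ℕ := fun s c => combParent h (home s) c
  let dep : Fin n → ℕ × ℕ → ℕ := fun s c => combDepth (home s) c
  have hpar : ∀ s c, V s c → c ≠ home s → c.1 < g ∧ c.2 < g → V s (par s c) ∧ CellAdj (par s c) c ∧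
      dep s (par s c) + 1 = dep s c ∧ (par s c).1 < g ∧ (par s c).2 < g :=
    fun s c h1 h2 h3 => combParent_spec h1 h2 (hhg s) h3
  let at' : ℕ × ℕ → Fin (P * P) → Fin n := fun c q => rel c (relayIndex c (e q))
  have hat : ∀ c q, c.1 < g ∧ c.2 < g → cl (at' c q) = c := fun c q hc => (hrel c hc).2 _
  have hatinj : ∀ c q q', c.1 < g ∧ c.2 < g → at' c q = at' c q' →
      relayIndex c (e q) = relayIndex c (e q') := fun c q q' hc hq => (hrel c hc).1 hq
  let Inject : Fin n → Fin (P * P) → Fin n → Fin n → ℕ → Prop := fun s q u v d =>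
    u = s ∧ v = at' (home s) q ∧ d = 0
  let Relay : Fin n → Fin (P * P) → Fin n → Fin n → ℕ → Prop := fun s q u v d =>
    ∃ c, (c.1 < g ∧ c.2 < g) ∧ V s c ∧ c ≠ home s ∧ u = at' (par s c) q ∧ v = at' c q ∧ d = dep s c
  let Deliver : Fin n → Fin (P * P) → Fin n → Fin n → ℕ → Prop := fun s q u v d =>
    ∃ k, v = D s k ∧ u = at' (home v) q ∧ d = dep s (home v) + 1
  let Job : Fin n → Fin (P * P) → Fin n → Fin n → ℕ → Prop := fun s q u v d =>
    Inject s q u v d ∨ Relay s q u v d ∨ Deliver s q u v d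
  have harrive : ∀ s q c, V s c → (c.1 < g ∧ c.2 < g) →
      ∃ u d, d ≤ dep s c ∧ Job s q u (at' c q) d := by
    intro s q c h1 h2
    by_cases hc : c = home s
    · exact ⟨s, 0, Nat.zero_le _, Or.inl ⟨rfl, by rw [hc], rfl⟩⟩
    · exact ⟨_, _, le_rfl, Or.inr (Or.inl ⟨c, h2, h1, hc, rfl, rfl, rfl⟩)⟩
  have hdep : ∀ s c, (c.1 < g ∧ c.2 < g) → dep s c ≤ 2 * g := by
    intro s c hc
    have := hhg s
    simp only [dep, combDepth, Nat.dist]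
    omega
  have hdelay : ∀ s q u v d, Job s q u v d → d ≤ 2 * g + 1 := by
    rintro s q u v d (⟨-, -, rfl⟩ | ⟨c, hc, -, -, -, -, rfl⟩ | ⟨k, rfl, -, rfl⟩)
    · omega
    · exact (hdep s c hc).trans (by omega)
    · have := hdep s _ (hhg (D s k)); omega
  let F : Fin n → Fin n → Finset (Fin n × Fin (P * P) × ℕ) := fun u v =>
    (Finset.univ ×ˢ Finset.univ ×ˢ Finset.range (2 * g + 2)).filter
      fun z => Job z.1 z.2.1 u v z.2.2
  have hmemF : ∀ s q u v d, Job s q u v d → (s, q, d) ∈ F u v := by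
    intro s q u v d hj
    have := hdelay _ _ _ _ _ hj
    simp only [F, Finset.mem_filter, Finset.mem_product, Finset.mem_univ, Finset.mem_range,
      true_and]
    exact ⟨by omega, hj⟩
  have hcard : ∀ u v, (F u v).card ≤ P + W + L * P := by
    intro u v
    have hsub : F u v ⊆ (F u v).filter (fun z => Inject z.1 z.2.1 u v z.2.2) ∪
        (F u v).filter (fun z => Relay z.1 z.2.1 u v z.2.2) ∪
        (F u v).filter (fun z => Deliver z.1 z.2.1 u v z.2.2) := by
      intro z hz
      have hj : Job z.1 z.2.1 u v z.2.2 := (Finset.mem_filter.1 hz).2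
      simp only [Finset.mem_union, Finset.mem_filter, hz, true_and, or_assoc]
      exact hj
    refine (Finset.card_le_card hsub).trans ((Finset.card_union_le _ _).trans
      (add_le_add ((Finset.card_union_le _ _).trans (add_le_add ?_ ?_)) ?_))
    -- Injection: the source is u, and the receiving relay fixes one coordinate of the packet,
    -- leaving P choices of the other.
    · have := Finset.card_le_card_of_injOn (s := (F u v).filter
          (fun z => Inject z.1 z.2.1 u v z.2.2)) (t := (Finset.univ : Finset (Fin P)))
        (fun z => otherIndex (home u) (e z.2.1)) (fun _ _ => Finset.mem_univ _) (by
          rintro ⟨s, q, d⟩ hz ⟨s', q', d'⟩ hz' hzz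
          obtain ⟨rfl, hv, rfl⟩ := (Finset.mem_filter.1 hz).2
          obtain ⟨rfl, hv', rfl⟩ := (Finset.mem_filter.1 hz').2
          have := he (eq_of_relayIndex_otherIndex (hatinj _ _ _ (hhg _) (hv.symm.trans hv')) hzz)
          simp only at this
          rw [this])
      simpa using this
    -- Relaying: the link determines the packet and the delay once the session is known, so the load
    -- is at most the number of sessions visiting the receiver's cell.
    · by_cases hemp : (F u v).filter (fun z => Relay z.1 z.2.1 u v z.2.2) = ∅
      · rw [hemp]; simp
      obtain ⟨z0, hz0⟩ := Finset.nonempty_iff_ne_empty.2 hemp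
      have hvg := hcl v
      refine le_trans ?_ (hW (cl v) (hcl v))
      rw [Set.ncard_eq_toFinset_card']
      refine Finset.card_le_card_of_injOn (fun z => z.1) ?_ ?_
      · rintro ⟨s, q, d⟩ hz
        obtain ⟨c, hc, hVc, -, -, hv, -⟩ := (Finset.mem_filter.1 hz).2
        have : cl v = c := by rw [hv]; exact hat _ _ hc
        simp only [Set.coe_toFinset, Set.mem_ofPred_eq]
        rw [this]; exact hVc
      · rintro ⟨s, q, d⟩ hz ⟨s', q', d'⟩ hz' hzz
        simp only at hzz
        subst hzz
        obtain ⟨c, hc, hVc, hne, hu, hv, hd⟩ := (Finset.mem_filter.1 hz).2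
        obtain ⟨c', hc', hVc', hne', hu', hv', hd'⟩ := (Finset.mem_filter.1 hz').2
        simp only at *
        have e1 : cl v = c := by rw [hv]; exact hat _ _ hc
        have e2 : cl v = c' := by rw [hv']; exact hat _ _ hc'
        obtain rfl : c = c' := e1.symm.trans e2
        obtain ⟨-, p2, -, p4⟩ := hpar s c hVc hne hc
        have := he (eq_of_relayIndex_adj p2 (hatinj _ _ _ p4 (hu.symm.trans hu'))
          (hatinj _ _ _ hc (hv.symm.trans hv')))
        rw [this, hd, hd']
    -- Delivery: at most L sessions end at v, and the transmitting relay leaves P packets for each.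
    · refine (Finset.card_le_card_of_injOn (t := {s : Fin n | ∃ k, D s k = v}.toFinset ×ˢ
        (Finset.univ : Finset (Fin P))) (fun z => (z.1, otherIndex (home v) (e z.2.1)))
        ?_ ?_).trans ?_
      · rintro ⟨s, q, d⟩ hz
        obtain ⟨k, hk, -, -⟩ := (Finset.mem_filter.1 hz).2
        simp only [Finset.coe_product, Set.mem_prod, Set.coe_toFinset, Set.mem_ofPred_eq,
          Finset.coe_univ, Set.mem_univ, and_true]
        exact ⟨k, hk.symm⟩
      · rintro ⟨s, q, d⟩ hz ⟨s', q', d'⟩ hz' hzz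
        obtain ⟨k, hk, hu, hd⟩ := (Finset.mem_filter.1 hz).2
        obtain ⟨k', hk', hu', hd'⟩ := (Finset.mem_filter.1 hz').2
        simp only [Prod.mk.injEq] at *
        obtain ⟨rfl, hzz⟩ := hzz
        have := he (eq_of_relayIndex_otherIndex (hatinj _ _ _ (hhg _) (hu.symm.trans hu')) hzz)
        exact ⟨rfl, this, hd.trans hd'.symm⟩
      · rw [Finset.card_product, ← Set.ncard_eq_toFinset_card', Finset.card_univ, Fintype.card_fin]
        exact Nat.mul_le_mul_right _ (hL v)
  choose rank hrank1 hrank2 using fun u v => exists_rank (F u v)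
  refine feasible_of_jobs hm X D hD (H := 2 * g + 1) (J := P + W + L * P) (Q := P * P) hCn (by omega)
    col hcol Job rank ?_ ?_ ?_ ?_ ?_ hdelay ?_
  · intro s q u v d hj
    exact (hrank1 u v _ (hmemF _ _ _ _ _ hj)).trans_le (hcard u v)
  · intro u v s q d s' q' d' hj hj' hr
    have := hrank2 u v (hmemF _ _ _ _ _ hj) (hmemF _ _ _ _ _ hj') hr
    simpa using this
  · rintro s q u v d (⟨rfl, rfl, -⟩ | ⟨c, hc, hVc, hne, rfl, rfl, -⟩ | ⟨k, hv, hu, -⟩)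
    · exact hair _ _ (by rw [hat _ _ (hhg _)]; exact hadj _)
    · obtain ⟨-, p2, -, p4⟩ := hpar s c hVc hne hc
      exact hair _ _ (by rw [hat _ _ hc, hat _ _ p4]; exact p2)
    · exact hair _ _ (by rw [hu, hat _ _ (hhg _)]; exact (hadj _).symm)
  · rintro s q u v d (⟨rfl, rfl, -⟩ | ⟨c, hc, hVc, hne, rfl, rfl, rfl⟩ | ⟨k, rfl, rfl, rfl⟩)
    · exact Or.inl rfl
    · obtain ⟨p1, -, p3, p4⟩ := hpar s c hVc hne hc
      obtain ⟨u', d', h1, h2⟩ := harrive s q _ p1 p4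
      exact Or.inr ⟨u', d', by omega, h2⟩
    · obtain ⟨u', d', h1, h2⟩ := harrive s q _ (combVisits_target h (home s)
        (fun k => home (D s k)) k) (hhg _)
      exact Or.inr ⟨u', d', by omega, h2⟩
  · intro s q k
    exact ⟨_, _, Or.inr (Or.inr ⟨k, rfl, rfl, rfl⟩)⟩
  · push_cast at hlam ⊢
    exact hlam

/-! ### Cell geometry and interference -/

/-- The index of the interval of length `1 / g` that contains a point of the unit interval. -/
def intervalIndex (g : ℕ) (t : ℝ) : ℕ := min ⌊g * t⌋₊ (g - 1)

/-- The cell of the `g × g` grid that contains a point of the unit square. -/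
def cellOf (g : ℕ) (x : Plane) : ℕ × ℕ := (intervalIndex g (x 0), intervalIndex g (x 1))

theorem intervalIndex_lt {g : ℕ} (hg : 0 < g) (t : ℝ) : intervalIndex g t < g := by
  unfold intervalIndex; omega

theorem cellOf_lt {g : ℕ} (hg : 0 < g) (x : Plane) : (cellOf g x).1 < g ∧ (cellOf g x).2 < g :=
  ⟨intervalIndex_lt hg _, intervalIndex_lt hg _⟩

theorem intervalIndex_mem {g : ℕ} (hg : 0 < g) {t : ℝ} (ht : t ∈ Set.Icc (0 : ℝ) 1) :
    (intervalIndex g t : ℝ) ≤ g * t ∧ g * t ≤ intervalIndex g t + 1 := by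
  have h0 : 0 ≤ (g : ℝ) * t := mul_nonneg (Nat.cast_nonneg _) ht.1
  have h1 : (g : ℝ) * t ≤ g := by nlinarith [ht.2, (Nat.cast_nonneg g : (0 : ℝ) ≤ g)]
  unfold intervalIndex
  constructor
  · exact le_trans (by exact_mod_cast min_le_left _ _) (Nat.floor_le h0)
  · rcases min_choice ⌊(g : ℝ) * t⌋₊ (g - 1) with h | h <;> rw [h]
    · exact (Nat.lt_floor_add_one _).le
    · rw [Nat.cast_sub hg]; simpa using h1

theorem dist_le_abs_add_abs (x y : Plane) : dist x y ≤ |x 0 - y 0| + |x 1 - y 1| := by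
  rw [EuclideanSpace.dist_eq, Fin.sum_univ_two, Real.dist_eq, Real.dist_eq]
  refine Real.sqrt_le_iff.2 ⟨by positivity, ?_⟩
  nlinarith [mul_nonneg (abs_nonneg (x 0 - y 0)) (abs_nonneg (x 1 - y 1))]

theorem abs_sub_le_dist (x y : Plane) (i : Fin 2) : |x i - y i| ≤ dist x y := by
  rw [← Real.dist_eq]
  exact PiLp.dist_apply_le x y i

theorem abs_sub_le_of_intervalIndex {g : ℕ} (hg : 0 < g) {s t : ℝ} (hs : s ∈ Set.Icc (0 : ℝ) 1)
    (ht : t ∈ Set.Icc (0 : ℝ) 1) {d : ℕ} (h1 : intervalIndex g s ≤ intervalIndex g t + d)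
    (h2 : intervalIndex g t ≤ intervalIndex g s + d) : |s - t| ≤ (d + 1) / g := by
  have hg' : (0 : ℝ) < g := by exact_mod_cast hg
  obtain ⟨a1, a2⟩ := intervalIndex_mem hg hs
  obtain ⟨b1, b2⟩ := intervalIndex_mem hg ht
  have h1' : (intervalIndex g s : ℝ) ≤ intervalIndex g t + d := by exact_mod_cast h1
  have h2' : (intervalIndex g t : ℝ) ≤ intervalIndex g s + d := by exact_mod_cast h2
  have habs : |s - t| * g = |(s - t) * g| := by rw [abs_mul, abs_of_pos hg']
  rw [le_div_iff₀ hg', habs, abs_le]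
  constructor <;> nlinarith

theorem le_abs_sub_of_intervalIndex {g : ℕ} (hg : 0 < g) {s t : ℝ} (hs : s ∈ Set.Icc (0 : ℝ) 1)
    (ht : t ∈ Set.Icc (0 : ℝ) 1) {d : ℕ} (h : intervalIndex g s + d ≤ intervalIndex g t ∨
      intervalIndex g t + d ≤ intervalIndex g s) : ((d : ℝ) - 1) / g ≤ |s - t| := by
  have hg' : (0 : ℝ) < g := by exact_mod_cast hg
  obtain ⟨a1, a2⟩ := intervalIndex_mem hg hs
  obtain ⟨b1, b2⟩ := intervalIndex_mem hg ht
  have habs : |s - t| * g = |(s - t) * g| := by rw [abs_mul, abs_of_pos hg']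
  rw [div_le_iff₀ hg', habs, le_abs]
  rcases h with h | h
  · have h' : (intervalIndex g s : ℝ) + d ≤ intervalIndex g t := by exact_mod_cast h
    right; nlinarith
  · have h' : (intervalIndex g t : ℝ) + d ≤ intervalIndex g s := by exact_mod_cast h
    left; nlinarith

theorem dist_le_of_cellAdj {g : ℕ} (hg : 0 < g) {x y : Plane} (hx : x ∈ unitSquare)
    (hy : y ∈ unitSquare) (h : CellAdj (cellOf g x) (cellOf g y)) : dist x y ≤ 3 / g := by
  refine (dist_le_abs_add_abs x y).trans ?_
  rcases h with ⟨h1, h2⟩ | ⟨h1, h2⟩ <;> simp only [cellOf] at h1 h2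
  · have e0 := abs_sub_le_of_intervalIndex hg (hx 0) (hy 0) (d := 0) (by omega) (by omega)
    have e1 := abs_sub_le_of_intervalIndex hg (hx 1) (hy 1) (d := 1) (by omega) (by omega)
    refine (add_le_add e0 e1).trans (le_of_eq ?_)
    push_cast; ring
  · have e0 := abs_sub_le_of_intervalIndex hg (hx 0) (hy 0) (d := 1) (by omega) (by omega)
    have e1 := abs_sub_le_of_intervalIndex hg (hx 1) (hy 1) (d := 0) (by omega) (by omega)
    refine (add_le_add e0 e1).trans (le_of_eq ?_)
    push_cast; ring

/-- The colour of a cell in the time-division schedule. -/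
def cellColour (M : ℕ) (c : ℕ × ℕ) : ℕ := (c.1 % M) * M + c.2 % M

theorem cellColour_lt {M : ℕ} (hM : 0 < M) (c : ℕ × ℕ) : cellColour M c < M * M := by
  have h1 := Nat.mod_lt c.1 hM
  have h2 := Nat.mod_lt c.2 hM
  unfold cellColour
  calc c.1 % M * M + c.2 % M < (c.1 % M + 1) * M := by rw [add_mul]; omega
    _ ≤ M * M := Nat.mul_le_mul_right _ h1

theorem cellColour_eq {M : ℕ} (hM : 0 < M) {a b : ℕ × ℕ} (h : cellColour M a = cellColour M b) :
    a.1 % M = b.1 % M ∧ a.2 % M = b.2 % M := by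
  unfold cellColour at h
  have ha := Nat.mod_lt a.2 hM
  have hb := Nat.mod_lt b.2 hM
  constructor
  · have := congrArg (· / M) h
    simpa [mul_comm _ M, Nat.mul_add_div hM, Nat.div_eq_of_lt ha, Nat.div_eq_of_lt hb] using this
  · have := congrArg (· % M) h
    simpa [Nat.mod_eq_of_lt ha, Nat.mod_eq_of_lt hb] using this

theorem add_le_of_mod_eq {M a b : ℕ} (h : a % M = b % M) (hne : a ≠ b) : a + M ≤ b ∨ b + M ≤ a := by
  rcases lt_or_gt_of_ne hne with hl | hl
  · left
    have := Nat.le_of_dvd (by omega) ((Nat.modEq_iff_dvd' hl.le).1 h)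
    omega
  · right
    have := Nat.le_of_dvd (by omega) ((Nat.modEq_iff_dvd' hl.le).1 h.symm)
    omega

theorem cellAdj_colour_ne {M : ℕ} (hM : 2 ≤ M) {a b : ℕ × ℕ} (h : CellAdj a b) :
    cellColour M b ≠ cellColour M a := by
  intro hc
  obtain ⟨h1, h2⟩ := cellColour_eq (by omega) hc
  have e1 := @add_le_of_mod_eq M _ _ h1
  have e2 := @add_le_of_mod_eq M _ _ h2
  unfold CellAdj at h
  omega

/-- A transmitter of the same colour is either in the cell of u, hence adjacent to the receiver and
resolved by it, or at least M cells from u in some coordinate. In the latter case it is at least M -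
1 cells from v, and positions inside the cells cost one more, which gives the M - 2 of `hMr`. -/
theorem interference_of_colour {n g M : ℕ} (hg : 0 < g) (hM : 2 ≤ M) {X : Fin n → Plane}
    (hX : ∀ i, X i ∈ unitSquare) {r Δ : ℝ} (hr : 3 / (g : ℝ) ≤ r)
    (hMr : (1 + Δ) * r * g ≤ M - 2) (u v : Fin n)
    (huv : CellAdj (cellOf g (X u)) (cellOf g (X v))) :
    dist (X u) (X v) ≤ r ∧ cellColour M (cellOf g (X v)) ≠ cellColour M (cellOf g (X u)) ∧
      ∀ k, cellColour M (cellOf g (X k)) = cellColour M (cellOf g (X u)) →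
        dist (X k) (X v) ≤ r ∨ (1 + Δ) * r ≤ dist (X k) (X v) := by
  have hg' : (0 : ℝ) < g := by exact_mod_cast hg
  refine ⟨(dist_le_of_cellAdj hg (hX u) (hX v) huv).trans hr, cellAdj_colour_ne hM huv, ?_⟩
  intro k hk
  obtain ⟨h1, h2⟩ := cellColour_eq (by omega) hk
  by_cases heq : cellOf g (X k) = cellOf g (X u)
  · left
    exact (dist_le_of_cellAdj hg (hX k) (hX v) (heq ▸ huv)).trans hr
  right
  have key : ∀ i, (intervalIndex g (X k i) + (M - 1) ≤ intervalIndex g (X v i) ∨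
      intervalIndex g (X v i) + (M - 1) ≤ intervalIndex g (X k i)) →
      (1 + Δ) * r ≤ dist (X k) (X v) := by
    intro i hi
    have := le_abs_sub_of_intervalIndex hg (hX k i) (hX v i) hi
    refine le_trans ?_ (this.trans (abs_sub_le_dist _ _ i))
    rw [le_div_iff₀ hg', Nat.cast_sub (by omega)]
    push_cast; linarith
  by_cases h1' : (cellOf g (X k)).1 = (cellOf g (X u)).1
  · have h2' : (cellOf g (X k)).2 ≠ (cellOf g (X u)).2 := fun h => heq (Prod.ext h1' h)
    have := add_le_of_mod_eq h2 h2'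
    apply key 1
    unfold CellAdj at huv
    simp only [cellOf] at *
    omega
  · have := add_le_of_mod_eq h1 h1'
    apply key 0
    unfold CellAdj at huv
    simp only [cellOf] at *
    omega

/-! ### Number of sessions through a cell -/

theorem ncard_preimage_le {α β : Type*} [Finite α] (f : α → β) (C : Finset β) {U : ℝ}
    (hU : ∀ c ∈ C, ({v | f v = c}.ncard : ℝ) ≤ U) : ({v | f v ∈ C}.ncard : ℝ) ≤ C.card * U := by
  classical
  have := Fintype.ofFinite α
  have : {v | f v ∈ C}.ncard = ∑ c ∈ C, {v | f v = c}.ncard := by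
    simp_rw [Set.ncard_eq_toFinset_card', Set.toFinset_ofPred]
    rw [Finset.card_eq_sum_card_fiberwise (f := f) (t := C) (fun v hv => by simpa using hv)]
    refine Finset.sum_congr rfl fun c hc => ?_
    congr 1
    ext v
    simp only [Finset.mem_filter, Finset.mem_univ, true_and]
    exact ⟨fun h => h.2, fun h => ⟨h ▸ hc, h⟩⟩
  rw [this]
  push_cast
  refine (Finset.sum_le_card_nsmul _ _ _ hU).trans (le_of_eq (by simp))

/-- The nodes whose branch from a tooth of the comb may pass through the cell `c`. -/
def branchSet {n : ℕ} (home : Fin n → ℕ × ℕ) (h : ℕ) (c : ℕ × ℕ) : Set (Fin n) :=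
  {v | (home v).1 = c.1 ∧ (home v).2 < c.2 + h ∧ c.2 < (home v).2 + h}

theorem besideCell_fst {c : ℕ × ℕ} {x : ℕ} (h : (besideCell c).1 = x) :
    c.1 ∈ ({x - 1, x + 1} : Finset ℕ) := by
  unfold besideCell at h
  simp only [Finset.mem_insert, Finset.mem_singleton] at *
  split_ifs at h <;> omega

/-- A home in a given column comes from a node in one of two columns, and fewer than 2h rows are
eligible, so at most 4h cells contribute. -/
theorem ncard_branchSet_le {n h : ℕ} (cl : Fin n → ℕ × ℕ) {U : ℝ}
    (hU : ∀ c, ({v | cl v = c}.ncard : ℝ) ≤ U) (c : ℕ × ℕ) :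
    ((branchSet (fun v => besideCell (cl v)) h c).ncard : ℝ) ≤ 4 * h * U := by
  have hU0 : 0 ≤ U := le_trans (Nat.cast_nonneg _) (hU (0, 0))
  have hsub : branchSet (fun v => besideCell (cl v)) h c ⊆
      {v | cl v ∈ ({c.1 - 1, c.1 + 1} : Finset ℕ) ×ˢ Finset.Ico (c.2 + 1 - h) (c.2 + h)} := by
    rintro v ⟨h1, h2, h3⟩
    have h1' := besideCell_fst h1
    simp only [besideCell] at h2 h3
    rw [Set.mem_ofPred_eq, Finset.mem_product, Finset.mem_Ico]
    exact ⟨h1', by omega, by omega⟩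
  have hc : ((({c.1 - 1, c.1 + 1} : Finset ℕ) ×ˢ Finset.Ico (c.2 + 1 - h) (c.2 + h)).card : ℝ)
      ≤ 4 * h := by
    rw [Finset.card_product, Nat.card_Ico]
    have h2 : ({c.1 - 1, c.1 + 1} : Finset ℕ).card ≤ 2 := Finset.card_le_two
    have : ({c.1 - 1, c.1 + 1} : Finset ℕ).card * (c.2 + h - (c.2 + 1 - h)) ≤ 2 * (2 * h) :=
      Nat.mul_le_mul h2 (by omega)
    calc _ ≤ ((2 * (2 * h) : ℕ) : ℝ) := by exact_mod_cast this
      _ = 4 * h := by push_cast; ring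
  calc ((branchSet (fun v => besideCell (cl v)) h c).ncard : ℝ) ≤ _ := by
        exact_mod_cast Set.ncard_le_ncard hsub (Set.toFinite _)
    _ ≤ _ := ncard_preimage_le cl _ fun c _ => hU c
    _ ≤ 4 * h * U := by gcongr

/-- Such rows are all congruent to y modulo h, hence determined by their quotient by h. -/
theorem card_dvd_dist_le {g h y : ℕ} :
    ((Finset.range g).filter fun r => h ∣ Nat.dist y r).card ≤ g / h + 1 := by
  have hmod : ∀ r, h ∣ Nat.dist y r → r % h = y % h := by
    intro r hr
    rcases le_total y r with hl | hl
    · rw [Nat.dist_eq_sub_of_le hl] at hr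
      exact ((Nat.modEq_iff_dvd' hl).2 hr).symm
    · rw [Nat.dist_eq_sub_of_le_right hl] at hr
      exact (Nat.modEq_iff_dvd' hl).2 hr
  rw [← Finset.card_range (g / h + 1)]
  refine Finset.card_le_card_of_injOn (fun r => r / h) ?_ ?_
  · intro r hr
    simp only [Finset.coe_filter, Finset.mem_range, Set.mem_ofPred_eq] at hr
    simp only [Finset.coe_range, Set.mem_Iio]
    exact Nat.lt_succ_of_le (Nat.div_le_div_right hr.1.le)
  · intro r hr r' hr' hrr
    simp only [Finset.coe_filter, Finset.mem_range, Set.mem_ofPred_eq] at hr hr' hrr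
    rw [← Nat.div_add_mod r h, ← Nat.div_add_mod r' h, hrr, hmod r hr.2, hmod r' hr'.2]

/-- Spine and teeth depend only on the cell of the source: the spine allows two columns of cells,
the teeth about g/h rows. Branches are counted through the destinations, one union term for each of
the m indices. -/
theorem ncard_combVisits_le {n m g h : ℕ} (hh : 0 < h) (cl : Fin n → ℕ × ℕ)
    (hcl : ∀ v, (cl v).1 < g ∧ (cl v).2 < g) (D : Destinations n m) {U V : ℝ}
    (hU : ∀ c, ({v | cl v = c}.ncard : ℝ) ≤ U) (c : ℕ × ℕ)
    (hV : ∀ k, ({s | D s k ∈ branchSet (fun v => besideCell (cl v)) h c}.ncard : ℝ) ≤ V) :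
    ({s : Fin n | CombVisits h (besideCell (cl s)) (fun k => besideCell (cl (D s k))) c}.ncard : ℝ)
      ≤ (2 * g + g * ((g / h : ℕ) + 1)) * U + m * V := by
  classical
  have hU0 : 0 ≤ U := le_trans (Nat.cast_nonneg _) (hU (0, 0))
  set C₁ : Finset (ℕ × ℕ) := ({c.1 - 1, c.1 + 1} : Finset ℕ) ×ˢ Finset.range g
  set C₂ : Finset (ℕ × ℕ) :=
    Finset.range g ×ˢ ((Finset.range g).filter fun r => h ∣ Nat.dist c.2 r)
  set B : Fin m → Finset (Fin n) := fun k =>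
    {s | D s k ∈ branchSet (fun v => besideCell (cl v)) h c}.toFinset
  have hsub : {s : Fin n | CombVisits h (besideCell (cl s)) (fun k => besideCell (cl (D s k))) c} ⊆
      ({v | cl v ∈ C₁} ∪ {v | cl v ∈ C₂}) ∪ ↑(Finset.univ.biUnion B) := by
    rintro s (h1 | h2 | ⟨k, h3, h4⟩)
    · left; left
      rw [Set.mem_ofPred_eq, Finset.mem_product, Finset.mem_range]
      exact ⟨besideCell_fst h1.symm, (hcl s).2⟩
    · left; right
      simp only [C₂, Set.mem_ofPred_eq, Finset.mem_product, Finset.mem_range, Finset.mem_filter]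
      exact ⟨(hcl s).1, (hcl s).2, h2⟩
    · right
      simp only [B, Finset.coe_biUnion, Finset.mem_coe, Finset.mem_univ, Set.iUnion_true,
        Set.mem_iUnion, Set.coe_toFinset]
      have := h4.lt hh
      exact ⟨k, h3.symm, this.2, this.1⟩
  have hC₁ : (C₁.card : ℝ) ≤ 2 * g := by
    rw [Finset.card_product, Finset.card_range]
    have h2 : ({c.1 - 1, c.1 + 1} : Finset ℕ).card ≤ 2 := Finset.card_le_two
    exact_mod_cast Nat.mul_le_mul_right g h2
  have hC₂ : (C₂.card : ℝ) ≤ g * ((g / h : ℕ) + 1) := by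
    rw [Finset.card_product, Finset.card_range]
    exact_mod_cast Nat.mul_le_mul_left g card_dvd_dist_le
  have h1 := (ncard_preimage_le cl C₁ fun c _ => hU c).trans (mul_le_mul_of_nonneg_right hC₁ hU0)
  have h2 := (ncard_preimage_le cl C₂ fun c _ => hU c).trans (mul_le_mul_of_nonneg_right hC₂ hU0)
  have h3 : ((Finset.univ.biUnion B).card : ℝ) ≤ m * V := by
    calc ((Finset.univ.biUnion B).card : ℝ) ≤ ((∑ k, (B k).card : ℕ) : ℝ) := by
          exact_mod_cast Finset.card_biUnion_le
      _ = ∑ k, ((B k).card : ℝ) := by push_cast; rfl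
      _ ≤ ∑ _k : Fin m, V := by
          refine Finset.sum_le_sum fun k _ => ?_
          rw [← Set.ncard_eq_toFinset_card']
          exact hV k
      _ = m * V := by simp
  have hle := (Set.ncard_le_ncard hsub (Set.toFinite _)).trans ((Set.ncard_union_le _ _).trans
    (add_le_add_left (Set.ncard_union_le _ _) _))
  rw [Set.ncard_coe_finset] at hle
  have hle' : ({s : Fin n | CombVisits h (besideCell (cl s))
      (fun k => besideCell (cl (D s k))) c}.ncard : ℝ) ≤ ({v | cl v ∈ C₁}.ncard : ℝ) +
      {v | cl v ∈ C₂}.ncard + (Finset.univ.biUnion B).card := by exact_mod_cast hle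
  linarith

/-- Comb routing over the nodes of the unit square: it suffices to control the occupancy of the
cells, the number of sessions with a destination in a given set of nodes, and the number of sessions
with a given destination. -/
theorem feasible_of_counts {n m : ℕ} (hm : 0 < m) {X : Fin n → Plane}
    (hX : ∀ i, X i ∈ unitSquare) {D : Destinations n m} (hD : D ∈ admissible n m)
    {r Δ lam U V : ℝ} {M g h P W L : ℕ} (hP : 0 < P) (hg : 1 < g) (hM : 2 ≤ M) (hh : 0 < h)
    (hr : 3 / (g : ℝ) ≤ r) (hMr : (1 + Δ) * r * g ≤ M - 2)
    (hlow : ∀ c : ℕ × ℕ, c.1 < g ∧ c.2 < g → P ≤ {v | cellOf g (X v) = c}.ncard)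
    (hU : ∀ c : ℕ × ℕ, c.1 < g ∧ c.2 < g → ({v | cellOf g (X v) = c}.ncard : ℝ) ≤ U)
    (hV : ∀ c : ℕ × ℕ, c.1 < g ∧ c.2 < g → ∀ k,
      ({s | D s k ∈ branchSet (fun v => besideCell (cellOf g (X v))) h c}.ncard : ℝ) ≤ V)
    (hL : ∀ v, {s : Fin n | ∃ k, D s k = v}.ncard ≤ L)
    (hW : (2 * g + g * ((g / h : ℕ) + 1)) * U + m * V ≤ W)
    (hlam : lam * (2 * ((M * M) * (P + W + L * P))) ≤ P * P) :
    Feasible X D r Δ lam := by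
  classical
  have hg0 : 0 < g := by omega
  have hrel : ∀ c : ℕ × ℕ, ∃ f : Fin P → Fin n, c.1 < g ∧ c.2 < g →
      Function.Injective f ∧ ∀ a, cellOf g (X (f a)) = c := by
    intro c
    by_cases hc : c.1 < g ∧ c.2 < g
    · have hcard : Fintype.card (Fin P) ≤ Fintype.card {v | cellOf g (X v) = c} := by
        rw [Fintype.card_fin, ← Nat.card_eq_fintype_card]
        exact hlow c hc
      obtain ⟨f⟩ := Function.Embedding.nonempty_of_card_le hcard
      exact ⟨fun a => (f a).1, fun _ => ⟨Subtype.val_injective.comp f.injective, fun a => (f a).2⟩⟩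
    · have hlow0 := hlow (0, 0) ⟨hg0, hg0⟩
      obtain ⟨v, -⟩ := (Set.ncard_pos (Set.toFinite _)).1 (hP.trans_le hlow0)
      exact ⟨fun _ => v, fun h => absurd h hc⟩
  choose rel hrel using hrel
  have hU0 : 0 ≤ U := le_trans (Nat.cast_nonneg _) (hU (0, 0) ⟨hg0, hg0⟩)
  have hU' : ∀ c, ({v | cellOf g (X v) = c}.ncard : ℝ) ≤ U := by
    intro c
    by_cases hc : c.1 < g ∧ c.2 < g
    · exact hU c hc
    · have : {v | cellOf g (X v) = c} = ∅ := by
        ext v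
        simp only [Set.mem_ofPred_eq, Set.mem_empty_iff_false, iff_false]
        rintro rfl
        exact hc (cellOf_lt hg0 _)
      rw [this]; simpa using hU0
  refine feasible_of_grid hm X D hD (Cn := M * M) (by positivity) hP hg (fun v => cellOf g (X v))
    (fun v => cellOf_lt hg0 _) rel hrel (fun v => cellColour M (cellOf g (X v)))
    (fun v => cellColour_lt (by omega) _)
    (fun u v huv => interference_of_colour hg0 hM hX hr hMr u v huv) (h := h) (W := W) ?_ hL ?_
  · intro c hc
    exact_mod_cast (ncard_combVisits_le hh (fun v => cellOf g (X v)) (fun v => cellOf_lt hg0 _) D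
      hU' c (hV c hc)).trans hW
  · push_cast
    exact hlam

/-! ### Chernoff bounds and the law of the positions -/

/-- Chernoff's bound for the number of coordinates of a product measure in given sets. It is an
upper tail bound for `θ > 0` and a lower tail bound for `θ < 0`. -/
theorem measure_pi_count_le {ι : Type*} [Fintype ι] {α : ι → Type*} [∀ i, MeasurableSpace (α i)]
    (ρ : ∀ i, Measure (α i)) [∀ i, IsProbabilityMeasure (ρ i)] {S : ∀ i, Set (α i)}
    (hS : ∀ i, MeasurableSet (S i)) {θ p L : ℝ}
    (hp : ∀ i, (Real.exp θ - 1) * (ρ i).real (S i) ≤ (Real.exp θ - 1) * p) :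
    Measure.pi ρ {x | θ * L ≤ θ * ({i | x i ∈ S i}.ncard : ℝ)} ≤
      ENNReal.ofReal (Real.exp (Fintype.card ι * ((Real.exp θ - 1) * p) - θ * L)) := by
  classical
  let f : ∀ i, α i → ℝ := fun i y => 1 + (S i).indicator (fun _ => Real.exp θ - 1) y
  have hind : ∀ i, Integrable ((S i).indicator fun _ => Real.exp θ - 1) (ρ i) := fun i =>
    (integrable_const _).indicator (hS i)
  have hf : ∀ i, Integrable (f i) (ρ i) := fun i => (integrable_const _).add (hind i)
  have hfval : ∀ i y, f i y = if y ∈ S i then Real.exp θ else 1 := by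
    intro i y
    simp only [f, Set.indicator_apply]
    split_ifs <;> ring
  have hprod : ∀ x : ∀ i, α i, ∏ i, f i (x i) = Real.exp (θ * ({i | x i ∈ S i}.ncard : ℝ)) := by
    intro x
    simp_rw [hfval]
    rw [Finset.prod_ite, Finset.prod_const, Finset.prod_const_one, mul_one, ← Real.exp_nat_mul,
      Set.ncard_eq_toFinset_card', Set.toFinset_ofPred, mul_comm]
  -- Independence factors the exponential moment, and 1 + y ≤ exp y bounds each factor. Markov's
  -- inequality then finishes.
  have hint : ∫ x, ∏ i, f i (x i) ∂Measure.pi ρ ≤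
      Real.exp (Fintype.card ι * ((Real.exp θ - 1) * p)) := by
    rw [integral_fintype_prod_eq_prod]
    have hi : ∀ i, ∫ y, f i y ∂ρ i = 1 + (Real.exp θ - 1) * (ρ i).real (S i) := by
      intro i
      rw [integral_add (integrable_const _) (hind i), integral_indicator_const _ (hS i)]
      simp [mul_comm]
    calc ∏ i, ∫ y, f i y ∂ρ i ≤ ∏ _i : ι, Real.exp ((Real.exp θ - 1) * p) := by
          refine Finset.prod_le_prod (fun i _ => ?_) fun i _ => ?_
          · refine integral_nonneg fun y => ?_
            rw [Pi.zero_apply, hfval]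
            split_ifs
            · positivity
            · exact zero_le_one
          · rw [hi, add_comm]
            exact (add_le_add_left (hp i) _).trans (Real.add_one_le_exp _)
      _ = _ := by rw [Finset.prod_const, ← Real.exp_nat_mul, Finset.card_univ]
  have hmk := mul_meas_ge_le_integral_of_nonneg (μ := Measure.pi ρ)
    (f := fun x => ∏ i, f i (x i)) (ae_of_all _ fun x => by
      simp only [hprod]; exact (Real.exp_pos _).le) (Integrable.fintype_prod_dep hf)
    (Real.exp (θ * L))
  have hset : {x : ∀ i, α i | Real.exp (θ * L) ≤ ∏ i, f i (x i)} =
      {x | θ * L ≤ θ * ({i | x i ∈ S i}.ncard : ℝ)} := by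
    ext x
    simp only [hprod, Real.exp_le_exp, Set.mem_ofPred_eq]
  rw [hset] at hmk
  rw [← ofReal_measureReal]
  refine ENNReal.ofReal_le_ofReal ?_
  rw [Real.exp_sub, le_div_iff₀ (Real.exp_pos _), mul_comm]
  exact hmk.trans hint

theorem volume_box (a b : Fin 2 → ℝ) :
    volume {x : Plane | ∀ i, x i ∈ Set.Icc (a i) (b i)} = ∏ i, ENNReal.ofReal (b i - a i) := by
  rw [← Real.volume_Icc_pi, ← (PiLp.volume_preserving_ofLp (Fin 2)).measure_preimage
    measurableSet_Icc.nullMeasurableSet, ← Set.pi_univ_Icc]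
  congr 1
  ext x
  simp [Pi.le_def]
  tauto

theorem volume_box_Ico (a b : Fin 2 → ℝ) :
    volume {x : Plane | ∀ i, x i ∈ Set.Ico (a i) (b i)} = ∏ i, ENNReal.ofReal (b i - a i) := by
  rw [← Real.volume_pi_Ico, ← (PiLp.volume_preserving_ofLp (Fin 2)).measure_preimage
    (MeasurableSet.univ_pi fun _ => measurableSet_Ico).nullMeasurableSet]
  congr 1
  ext x
  simp

theorem measurableSet_unitSquare : MeasurableSet unitSquare := by
  unfold unitSquare
  rw [show {x : Plane | ∀ i, x i ∈ Set.Icc (0 : ℝ) 1} = ⋂ i, {x : Plane | x i ∈ Set.Icc (0 : ℝ) 1} by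
    ext; simp]
  exact MeasurableSet.iInter fun i =>
    (show Measurable fun x : Plane => x i by fun_prop) measurableSet_Icc

instance : IsProbabilityMeasure ((volume : Measure Plane).restrict unitSquare) := by
  constructor
  rw [Measure.restrict_apply_univ]
  have := volume_box (fun _ => 0) (fun _ => 1)
  simpa [unitSquare] using this

theorem measurable_intervalIndex (g : ℕ) : Measurable (intervalIndex g) :=
  (Nat.measurable_floor.comp (measurable_const.mul measurable_id)).min measurable_const

theorem measurable_cellOf (g : ℕ) : Measurable (cellOf g) :=
  ((measurable_intervalIndex g).comp (by fun_prop)).prodMk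
    ((measurable_intervalIndex g).comp (by fun_prop))

/-- Because of the truncation in `intervalIndex`, the last cells contain their outer sides.
Sandwiching between a half-open and a closed box of equal volume avoids distinguishing these cases.
-/
theorem measureReal_cell {g : ℕ} (c : ℕ × ℕ) (hc : c.1 < g ∧ c.2 < g) :
    ((volume : Measure Plane).restrict unitSquare).real {x | cellOf g x = c} = 1 / (g : ℝ) ^ 2 := by
  have hg0 : 0 < g := by omega
  have hg : (0 : ℝ) < g := by exact_mod_cast hg0
  let a : Fin 2 → ℕ := ![c.1, c.2]
  have ha : ∀ i, a i < g := by
    intro i; fin_cases i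
    · exact hc.1
    · exact hc.2
  have hval : ∀ x : Plane, cellOf g x = c ↔ ∀ i, intervalIndex g (x i) = a i := by
    intro x
    rw [Fin.forall_fin_two]
    exact Prod.ext_iff
  have hside : ∏ i : Fin 2, ENNReal.ofReal ((a i + 1 : ℝ) / g - a i / g) =
      ENNReal.ofReal (1 / (g : ℝ) ^ 2) := by
    rw [← ENNReal.ofReal_prod_of_nonneg]
    · congr 1
      rw [Fin.prod_univ_two]
      field_simp
      ring
    · intro i _
      rw [← sub_div]
      have : (a i + 1 : ℝ) - a i = 1 := by ring
      rw [this]; positivity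
  have key : ((volume : Measure Plane).restrict unitSquare) {x | cellOf g x = c} =
      ENNReal.ofReal (1 / (g : ℝ) ^ 2) := by
    have hmeas : MeasurableSet {x | cellOf g x = c} :=
      measurable_cellOf g (measurableSet_singleton c)
    rw [Measure.restrict_apply hmeas]
    apply le_antisymm
    · rw [← hside, ← volume_box]
      refine measure_mono ?_
      rintro x ⟨hx1, hx2⟩ i
      have := intervalIndex_mem hg0 (hx2 i)
      rw [(hval x).1 hx1 i] at this
      constructor
      · rw [div_le_iff₀ hg]; linarith
      · rw [le_div_iff₀ hg]; linarith
    · rw [← hside, ← volume_box_Ico]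
      refine measure_mono ?_
      intro x hx
      have hb : ∀ i, (a i : ℝ) ≤ g * x i ∧ g * x i < a i + 1 := by
        intro i
        obtain ⟨h1, h2⟩ := hx i
        rw [div_le_iff₀ hg] at h1
        rw [lt_div_iff₀ hg] at h2
        constructor <;> linarith
      constructor
      · refine (hval x).2 fun i => ?_
        have hfl : ⌊(g : ℝ) * x i⌋₊ = a i :=
          (Nat.floor_eq_iff ((Nat.cast_nonneg _).trans (hb i).1)).2 (hb i)
        have := ha i
        unfold intervalIndex
        omega
      · intro i
        have h0 : (0 : ℝ) ≤ a i := Nat.cast_nonneg _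
        have h1 : (a i + 1 : ℝ) ≤ g := by exact_mod_cast ha i
        obtain ⟨h2, h3⟩ := hb i
        constructor <;> nlinarith
  rw [measureReal_def, key, ENNReal.toReal_ofReal (by positivity)]

/-! ### Law of the destinations -/

/-- The admissible choices of the destinations of one source. -/
def admissibleAt (n m : ℕ) (s : Fin n) : Set (Fin m → Fin n) :=
  {d | Function.Injective d ∧ ∀ k, d k ≠ s}

/-- Admissibility constrains each source separately. This gives independence over the sources, as
the Chernoff bound requires; the destinations of one source remain dependent. -/
theorem uniformOn_admissible (n m : ℕ) :
    uniformOn (admissible n m) = Measure.pi fun s => uniformOn (admissibleAt n m s) := by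
  rw [← uniformOn_pi]
  congr 1
  ext D
  simp [admissible, admissibleAt, Set.mem_pi]

theorem admissibleAt_nonempty {n m : ℕ} (h : m < n) (s : Fin n) : (admissibleAt n m s).Nonempty := by
  have hcard : Fintype.card (Fin m) ≤ Fintype.card {v : Fin n // v ≠ s} := by
    rw [Fintype.card_subtype_compl]
    simp
    omega
  obtain ⟨f⟩ := Function.Embedding.nonempty_of_card_le hcard
  exact ⟨fun k => (f k).1, Subtype.val_injective.comp f.injective, fun k => (f k).2⟩

theorem isProbabilityMeasure_admissibleAt {n m : ℕ} (h : m < n) (s : Fin n) :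
    IsProbabilityMeasure (uniformOn (admissibleAt n m s)) :=
  isProbabilityMeasure_uniformOn (Set.toFinite _) (admissibleAt_nonempty h s)

/-- Exchanging v and w is a bijection between the two sets: both differ from s, so s stays fixed and
admissibility is preserved. -/
theorem card_admissibleAt_eq {n m : ℕ} (s : Fin n) (k : Fin m) {v w : Fin n} (hv : v ≠ s)
    (hw : w ≠ s) : (admissibleAt n m s ∩ {d | d k = v}).ncard =
      (admissibleAt n m s ∩ {d | d k = w}).ncard := by
  have hmap : ∀ {v w : Fin n}, v ≠ s → w ≠ s → ∀ d ∈ admissibleAt n m s ∩ {d | d k = v},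
      (fun j => Equiv.swap v w (d j)) ∈ admissibleAt n m s ∩ {d | d k = w} := by
    rintro v w hv hw d ⟨⟨hd1, hd2⟩, hd3⟩
    refine ⟨⟨(Equiv.injective _).comp hd1, fun j hj => hd2 j ?_⟩, ?_⟩
    · rw [← Equiv.swap_apply_of_ne_of_ne hv.symm hw.symm] at hj
      exact Equiv.injective _ hj
    · have hd3' : d k = v := hd3
      simp [hd3']
  refine Set.ncard_congr (fun d _ => fun j => Equiv.swap v w (d j)) (hmap hv hw) ?_ ?_
  · intro d d' _ _ h
    funext j
    exact Equiv.injective _ (congrFun h j)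
  · intro d hd
    refine ⟨fun j => Equiv.swap v w (d j), ?_, ?_⟩
    · rw [Equiv.swap_comm]; exact hmap hw hv d hd
    · funext j; simp

theorem ncard_eq_sum_fiber {β γ : Type*} [Finite β] (A : Set β) (f : β → γ) (t : Finset γ)
    (h : ∀ d ∈ A, f d ∈ t) : A.ncard = ∑ w ∈ t, (A ∩ {d | f d = w}).ncard := by
  classical
  have := Fintype.ofFinite β
  simp_rw [Set.ncard_eq_toFinset_card']
  rw [Finset.card_eq_sum_card_fiberwise (f := f) (t := t) (fun v hv => h v (by simpa using hv))]
  refine Finset.sum_congr rfl fun c _ => ?_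
  congr 1
  ext v
  simp

theorem measureReal_uniformOn {Ω : Type*} [Finite Ω] [MeasurableSpace Ω] [MeasurableSingletonClass Ω]
    (A t : Set Ω) : (uniformOn A).real t = (A ∩ t).ncard / (A.ncard : ℝ) := by
  have hc : ∀ s : Set Ω, (Measure.count s).toReal = s.ncard := by
    intro s
    rw [Measure.count_apply_finite s (Set.toFinite s), Set.ncard_eq_toFinset_card s]
    simp
  rw [measureReal_def, uniformOn, cond_apply (Set.toFinite A).measurableSet, ENNReal.toReal_mul,
    ENNReal.toReal_inv, hc, hc]
  field_simp

theorem measureReal_dest_eq_le {n m : ℕ} (h : m < n) (s : Fin n) (k : Fin m) (v : Fin n) :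
    (uniformOn (admissibleAt n m s)).real {d | d k = v} ≤ 1 / ((n : ℝ) - 1) := by
  classical
  have hn : 2 ≤ n := by have := k.2; omega
  have hn' : (0 : ℝ) < (n : ℝ) - 1 := by
    have : (2 : ℝ) ≤ n := by exact_mod_cast hn
    linarith
  set A := admissibleAt n m s with hA
  have hApos : 0 < A.ncard := (Set.ncard_pos (Set.toFinite _)).2 (admissibleAt_nonempty h s)
  rw [measureReal_uniformOn]
  by_cases hv : v = s
  · have : A ∩ {d | d k = v} = ∅ := by
      ext d
      simp only [Set.mem_inter_iff, Set.mem_ofPred_eq, Set.mem_empty_iff_false, iff_false, not_and]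
      exact fun hd hk => hd.2 k (hk.trans hv)
    rw [this]; simp; omega
  · have hsum : A.ncard = (n - 1) * (A ∩ {d | d k = v}).ncard := by
      rw [ncard_eq_sum_fiber A (fun d => d k) (Finset.univ.erase s) fun d hd =>
        Finset.mem_erase.2 ⟨hd.2 k, Finset.mem_univ _⟩, Finset.sum_congr rfl fun w hw =>
        card_admissibleAt_eq s k (Finset.ne_of_mem_erase hw) hv, Finset.sum_const,
        Finset.card_erase_of_mem (Finset.mem_univ _)]
      simp [hA]
    have hsum' : (A.ncard : ℝ) = ((n : ℝ) - 1) * (A ∩ {d | d k = v}).ncard := by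
      rw [hsum]; push_cast [Nat.cast_sub (show 1 ≤ n by omega)]; ring
    rw [div_le_div_iff₀ (by exact_mod_cast hApos) hn', hsum']
    linarith

theorem measureReal_dest_mem_le {n m : ℕ} (h : m < n) (s : Fin n) (k : Fin m) (B : Set (Fin n)) :
    (uniformOn (admissibleAt n m s)).real {d | d k ∈ B} ≤ B.ncard / ((n : ℝ) - 1) := by
  classical
  have := isProbabilityMeasure_admissibleAt h s
  have heq : {d : Fin m → Fin n | d k ∈ B} = ⋃ v ∈ B.toFinset, {d | d k = v} := by
    ext d; simp
  rw [heq]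
  refine (measureReal_biUnion_finset_le _ _).trans ((Finset.sum_le_card_nsmul _ _ _
    fun v _ => measureReal_dest_eq_le h s k v).trans (le_of_eq ?_))
  rw [Set.ncard_eq_toFinset_card', nsmul_eq_mul, mul_one_div]

theorem measureReal_exists_dest_eq_le {n m : ℕ} (h : m < n) (s v : Fin n) :
    (uniformOn (admissibleAt n m s)).real {d | ∃ k, d k = v} ≤ m / ((n : ℝ) - 1) := by
  have := isProbabilityMeasure_admissibleAt h s
  have heq : {d : Fin m → Fin n | ∃ k, d k = v} = ⋃ k, {d | d k = v} := by
    ext d; simp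
  rw [heq]
  refine (measureReal_iUnion_fintype_le _).trans ((Finset.sum_le_card_nsmul _ _ _
    fun k _ => measureReal_dest_eq_le h s k v).trans (le_of_eq ?_))
  rw [nsmul_eq_mul, mul_one_div]; simp

/-! ### Regular networks are likely -/

/-- Every cell of the grid holds between `μ / 4` and `4 μ` nodes. -/
def Balanced {n : ℕ} (g : ℕ) (μ : ℝ) (cl : Fin n → ℕ × ℕ) : Prop :=
  ∀ c : ℕ × ℕ, c.1 < g ∧ c.2 < g →
    μ / 4 < ({v | cl v = c}.ncard : ℝ) ∧ ({v | cl v = c}.ncard : ℝ) < 4 * μ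

theorem Balanced.ncard_le {n g : ℕ} {μ : ℝ} {cl : Fin n → ℕ × ℕ} (h : Balanced g μ cl) (hμ : 0 ≤ μ)
    (hcl : ∀ v, (cl v).1 < g ∧ (cl v).2 < g) (c : ℕ × ℕ) :
    ({v | cl v = c}.ncard : ℝ) ≤ 4 * μ := by
  by_cases hc : c.1 < g ∧ c.2 < g
  · exact (h c hc).2.le
  · have : {v | cl v = c} = ∅ := by
      ext v
      simp only [Set.mem_ofPred_eq, Set.mem_empty_iff_false, iff_false]
      rintro rfl
      exact hc (hcl _)
    rw [this]; simpa using hμ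

/-- The law of the positions of the nodes. -/
abbrev positionLaw (n : ℕ) : Measure (Fin n → Plane) :=
  Measure.pi fun _ : Fin n => (volume : Measure Plane).restrict unitSquare

/-- Chernoff with θ = 1 and θ = -1: both e - 1 - 4 and 1/e - 1 + 1/4 are at most -1/4. The rest is a
union over the g² cells and the two tails. -/
theorem positionLaw_not_balanced_le {n g : ℕ} {μ : ℝ} (hμ : μ = n / (g : ℝ) ^ 2) :
    positionLaw n {X | ¬ Balanced g μ fun i => cellOf g (X i)} ≤
      ENNReal.ofReal (2 * (g : ℝ) ^ 2 * Real.exp (-μ / 4)) := by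
  have hμ0 : 0 ≤ μ := by rw [hμ]; positivity
  have hsub : {X : Fin n → Plane | ¬ Balanced g μ fun i => cellOf g (X i)} ⊆
      ⋃ c ∈ Finset.range g ×ˢ Finset.range g,
        ({X : Fin n → Plane | (1 : ℝ) * (4 * μ) ≤ 1 * ({i | X i ∈ {x | cellOf g x = c}}.ncard : ℝ)} ∪
        {X : Fin n → Plane |
          (-1 : ℝ) * (μ / 4) ≤ -1 * ({i | X i ∈ {x | cellOf g x = c}}.ncard : ℝ)}) := by
    intro X hX
    simp only [Set.mem_ofPred_eq, Balanced, not_forall] at hX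
    obtain ⟨c, hc, h⟩ := hX
    simp only [Set.mem_iUnion]
    refine ⟨c, by simpa using hc, ?_⟩
    simp only [Set.mem_union, Set.mem_ofPred_eq]
    by_contra hcon
    push Not at hcon
    exact h ⟨by linarith [hcon.2], by linarith [hcon.1]⟩
  have he1 := Real.exp_one_lt_d9
  have he2 := Real.exp_one_gt_d9
  have hone : ∀ c ∈ Finset.range g ×ˢ Finset.range g, positionLaw n
      ({X : Fin n → Plane | (1 : ℝ) * (4 * μ) ≤ 1 * ({i | X i ∈ {x | cellOf g x = c}}.ncard : ℝ)} ∪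
        {X : Fin n → Plane |
          (-1 : ℝ) * (μ / 4) ≤ -1 * ({i | X i ∈ {x | cellOf g x = c}}.ncard : ℝ)}) ≤
      ENNReal.ofReal (2 * Real.exp (-μ / 4)) := by
    intro c hc
    have hc' : c.1 < g ∧ c.2 < g := by simpa using hc
    have hmeas : MeasurableSet {x | cellOf g x = c} :=
      measurable_cellOf g (measurableSet_singleton c)
    have h1 := measure_pi_count_le (fun _ : Fin n => (volume : Measure Plane).restrict unitSquare)
      (S := fun _ => {x | cellOf g x = c}) (fun _ => hmeas) (θ := 1) (p := 1 / (g : ℝ) ^ 2)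
      (L := 4 * μ) (fun _ => by rw [measureReal_cell c hc'])
    have h2 := measure_pi_count_le (fun _ : Fin n => (volume : Measure Plane).restrict unitSquare)
      (S := fun _ => {x | cellOf g x = c}) (fun _ => hmeas) (θ := -1) (p := 1 / (g : ℝ) ^ 2)
      (L := μ / 4) (fun _ => by rw [measureReal_cell c hc'])
    refine (measure_union_le _ _).trans ((add_le_add h1 h2).trans ?_)
    rw [← ENNReal.ofReal_add (Real.exp_pos _).le (Real.exp_pos _).le]
    refine ENNReal.ofReal_le_ofReal ?_
    rw [two_mul, Fintype.card_fin]
    have hn : ∀ t : ℝ, (n : ℝ) * (t * (1 / (g : ℝ) ^ 2)) = t * μ := by intro t; rw [hμ]; ring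
    rw [hn, hn]
    have he3 : Real.exp (-1) ≤ 1 / 2 := by
      rw [Real.exp_neg, inv_eq_one_div]
      exact one_div_le_one_div_of_le (by norm_num) (by linarith)
    refine add_le_add (Real.exp_le_exp.2 ?_) (Real.exp_le_exp.2 ?_) <;> nlinarith
  refine (measure_mono hsub).trans ((measure_biUnion_finset_le _ _).trans
    ((Finset.sum_le_card_nsmul _ _ _ hone).trans (le_of_eq ?_)))
  rw [Finset.card_product, Finset.card_range, nsmul_eq_mul, ← ENNReal.ofReal_natCast,
    ← ENNReal.ofReal_mul (Nat.cast_nonneg _)]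
  congr 1
  push_cast; ring

/-- Each source hits B with probability at most b/(n - 1), so the mean is at most 2b, and 2(e - 1) ≤
4. -/
theorem uniformOn_admissible_count_le {n m : ℕ} (h : m < n) (k : Fin m) (B : Set (Fin n)) {b V : ℝ}
    (hB : (B.ncard : ℝ) ≤ b) :
    uniformOn (admissible n m) {D | V ≤ ({s | D s k ∈ B}.ncard : ℝ)} ≤
      ENNReal.ofReal (Real.exp (4 * b - V)) := by
  have := isProbabilityMeasure_admissibleAt h
  have hn : (2 : ℝ) ≤ n := by have := k.2; exact_mod_cast (by omega : 2 ≤ n)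
  have he1 := Real.exp_one_lt_d9
  have he2 := Real.exp_one_gt_d9
  have hb : 0 ≤ b := le_trans (Nat.cast_nonneg _) hB
  have h1 := measure_pi_count_le (fun s : Fin n => uniformOn (admissibleAt n m s))
    (S := fun _ => {d | d k ∈ B}) (fun _ => (Set.toFinite _).measurableSet) (θ := 1)
    (p := b / ((n : ℝ) - 1)) (L := V) (fun s => by
      refine mul_le_mul_of_nonneg_left ((measureReal_dest_mem_le h s k B).trans ?_) (by linarith)
      exact div_le_div_of_nonneg_right hB (by linarith))
  rw [uniformOn_admissible]
  simp only [one_mul] at h1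
  refine h1.trans (ENNReal.ofReal_le_ofReal (Real.exp_le_exp.2 ?_))
  rw [Fintype.card_fin]
  have : (n : ℝ) * (b / ((n : ℝ) - 1)) ≤ 2 * b := by
    rw [mul_div_assoc', div_le_iff₀ (by linarith)]
    nlinarith
  have h2 : 0 ≤ (n : ℝ) * (b / ((n : ℝ) - 1)) :=
    mul_nonneg (by linarith) (div_nonneg hb (by linarith))
  nlinarith

/-- The mean is only about m, so θ stays free: the balls-in-bins threshold log n / log log n is
reached by letting θ grow with n. -/
theorem uniformOn_admissible_indegree_le {n m : ℕ} (hm : 0 < m) (h : m < n) (v : Fin n) {θ L : ℝ}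
    (hθ : 0 < θ) : uniformOn (admissible n m) {D | L ≤ ({s | ∃ k, D s k = v}.ncard : ℝ)} ≤
      ENNReal.ofReal (Real.exp (2 * m * Real.exp θ - θ * L)) := by
  have := isProbabilityMeasure_admissibleAt h
  have hn : (2 : ℝ) ≤ n := by exact_mod_cast (by omega : 2 ≤ n)
  have he := Real.add_one_le_exp θ
  have h1 := measure_pi_count_le (fun s : Fin n => uniformOn (admissibleAt n m s))
    (S := fun _ => {d | ∃ k, d k = v}) (fun _ => (Set.toFinite _).measurableSet) (θ := θ)
    (p := m / ((n : ℝ) - 1)) (L := L) (fun s =>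
      mul_le_mul_of_nonneg_left (measureReal_exists_dest_eq_le h s v) (by linarith))
  rw [uniformOn_admissible]
  simp only [mul_le_mul_iff_right₀ hθ] at h1
  refine h1.trans (ENNReal.ofReal_le_ofReal (Real.exp_le_exp.2 ?_))
  rw [Fintype.card_fin]
  have h3 : (n : ℝ) * (m / ((n : ℝ) - 1)) ≤ 2 * m := by
    rw [mul_div_assoc', div_le_iff₀ (by linarith)]
    nlinarith [(Nat.cast_nonneg m : (0 : ℝ) ≤ m)]
  have h2 : 0 ≤ (n : ℝ) * (m / ((n : ℝ) - 1)) :=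
    mul_nonneg (by linarith) (div_nonneg (Nat.cast_nonneg _) (by linarith))
  nlinarith

/-- The networks on which the balanced comb routing works. -/
def regularNetworks (n m g h : ℕ) (μ L : ℝ) : Set ((Fin n → Plane) × Destinations n m) :=
  {ω | (∀ i, ω.1 i ∈ unitSquare) ∧ ω.2 ∈ admissible n m ∧
    (Balanced g μ fun i => cellOf g (ω.1 i)) ∧
    (∀ c : ℕ × ℕ, c.1 < g ∧ c.2 < g → ∀ k, ({s | ω.2 s k ∈
      branchSet (fun v => besideCell (cellOf g (ω.1 v))) h c}.ncard : ℝ) < 128 * h * μ) ∧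
    ∀ v, ({s | ∃ k, ω.2 s k = v}.ncard : ℝ) < L}

theorem isProbabilityMeasure_admissible {n m : ℕ} (h : m < n) :
    IsProbabilityMeasure (uniformOn (admissible n m)) := by
  have := isProbabilityMeasure_admissibleAt h
  rw [uniformOn_admissible]
  infer_instance

/-- Branch sets depend on the positions, so Fubini is used to fix these first. Over balanced
positions a branch set is a fixed set of at most b = 16hμ nodes, and the threshold 128hμ exceeds 4b
by 64hμ; the union runs over g² cells and m indices. -/
theorem networkLaw_regular_compl_le {n m g h : ℕ} {μ θ L : ℝ} (hm : 0 < m) (hmn : m < n)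
    (hg : 0 < g) (hμ : μ = n / (g : ℝ) ^ 2) (hθ : 0 < θ) :
    networkLaw n m (regularNetworks n m g h μ L)ᶜ ≤
      ENNReal.ofReal (2 * (g : ℝ) ^ 2 * Real.exp (-μ / 4)) +
      ENNReal.ofReal ((g : ℝ) ^ 2 * (m * Real.exp (-(64 * h * μ)))) +
      ENNReal.ofReal (n * Real.exp (2 * m * Real.exp θ - θ * L)) := by
  have hμ0 : 0 ≤ μ := by rw [hμ]; positivity
  have := isProbabilityMeasure_admissible hmn
  set ν := uniformOn (admissible n m) with hν
  set bal : Set (Fin n → Plane) := {X | Balanced g μ fun i => cellOf g (X i)} with hbal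
  set heavy : Set ((Fin n → Plane) × Destinations n m) := {ω | ω.1 ∈ bal ∧
    ∃ c : ℕ × ℕ, (c.1 < g ∧ c.2 < g) ∧ ∃ k, 128 * h * μ ≤ ({s | ω.2 s k ∈
      branchSet (fun v => besideCell (cellOf g (ω.1 v))) h c}.ncard : ℝ)} with hheavy
  set full : Set (Destinations n m) := {D | ∃ v, L ≤ ({s | ∃ k, D s k = v}.ncard : ℝ)} with hfull
  have hsub : (regularNetworks n m g h μ L)ᶜ ⊆
      {X | ¬ ∀ i, X i ∈ unitSquare} ×ˢ Set.univ ∪ Set.univ ×ˢ (admissible n m)ᶜ ∪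
        balᶜ ×ˢ Set.univ ∪ heavy ∪ Set.univ ×ˢ full := by
    intro ω hω
    by_contra hcon
    simp only [Set.mem_union, Set.mem_prod, Set.mem_univ, and_true, true_and, Set.mem_compl_iff,
      not_or, not_not, Set.mem_ofPred_eq] at hcon
    obtain ⟨⟨⟨⟨h1, h2⟩, h3⟩, h4⟩, h5⟩ := hcon
    refine hω ⟨h1, h2, h3, fun c hc k => ?_, fun v => ?_⟩
    · by_contra hk
      exact h4 ⟨h3, c, hc, k, not_lt.1 hk⟩
    · by_contra hk
      exact h5 ⟨v, not_lt.1 hk⟩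
  have hsq : positionLaw n {X | ¬ ∀ i, X i ∈ unitSquare} = 0 := by
    have : ∀ᵐ X ∂positionLaw n, ∀ i, X i ∈ unitSquare := by
      rw [ae_all_iff]
      intro i
      exact (Measure.quasiMeasurePreserving_eval
        (fun _ : Fin n => (volume : Measure Plane).restrict unitSquare) i).ae
        (ae_restrict_mem measurableSet_unitSquare)
    exact this
  have hadm : ν (admissible n m)ᶜ = 0 := by
    rw [hν, uniformOn_eq_zero_iff (Set.toFinite _)]
    simp
  have hheavyle : ((positionLaw n).prod ν) heavy ≤
      ENNReal.ofReal ((g : ℝ) ^ 2 * (m * Real.exp (-(64 * h * μ)))) := by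
    -- The event depends on the positions only through the cells of the nodes, and thus factors
    -- through a countable space.
    have hmeas : MeasurableSet heavy := by
      have hΦ : Measurable fun ω : (Fin n → Plane) × Destinations n m =>
          ((fun i => cellOf g (ω.1 i)), ω.2) :=
        (measurable_pi_lambda _ fun i => (measurable_cellOf g).comp
          ((measurable_pi_apply i).comp measurable_fst)).prodMk measurable_snd
      exact hΦ ((Set.to_countable {z : (Fin n → ℕ × ℕ) × Destinations n m | Balanced g μ z.1 ∧
        ∃ c : ℕ × ℕ, (c.1 < g ∧ c.2 < g) ∧ ∃ k, 128 * h * μ ≤ ({s | z.2 s k ∈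
          branchSet (fun v => besideCell (z.1 v)) h c}.ncard : ℝ)}).measurableSet)
    rw [Measure.prod_apply hmeas]
    have hfib : ∀ X, ν (Prod.mk X ⁻¹' heavy) ≤
        ENNReal.ofReal ((g : ℝ) ^ 2 * (m * Real.exp (-(64 * h * μ)))) := by
      intro X
      by_cases hX : X ∈ bal
      · have hcell := Balanced.ncard_le hX hμ0 fun v => cellOf_lt hg _
        have hcov : Prod.mk X ⁻¹' heavy ⊆ ⋃ c ∈ Finset.range g ×ˢ Finset.range g,
            ⋃ k, {D : Destinations n m | 128 * h * μ ≤ ({s | D s k ∈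
              branchSet (fun v => besideCell (cellOf g (X v))) h c}.ncard : ℝ)} := by
          rintro D ⟨-, c, hc, k, hk⟩
          simp only [Set.mem_iUnion]
          exact ⟨c, by simpa using hc, k, hk⟩
        refine (measure_mono hcov).trans ((measure_biUnion_finset_le _ _).trans
          ((Finset.sum_le_card_nsmul _ _ (ENNReal.ofReal (m * Real.exp (-(64 * h * μ))))
            fun c _ => ?_).trans (le_of_eq ?_)))
        · refine (measure_iUnion_fintype_le _ _).trans ((Finset.sum_le_card_nsmul _ _
            (ENNReal.ofReal (Real.exp (-(64 * h * μ)))) fun k _ => ?_).trans (le_of_eq ?_))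
          · have hB := ncard_branchSet_le (h := h) (fun v => cellOf g (X v)) hcell c
            refine (uniformOn_admissible_count_le hmn k _ hB).trans (le_of_eq ?_)
            congr 2; ring
          · rw [Finset.card_univ, Fintype.card_fin, nsmul_eq_mul, ← ENNReal.ofReal_natCast,
              ← ENNReal.ofReal_mul (Nat.cast_nonneg _)]
        · rw [Finset.card_product, Finset.card_range, nsmul_eq_mul, ← ENNReal.ofReal_natCast,
            ← ENNReal.ofReal_mul (Nat.cast_nonneg _)]
          congr 1
          push_cast; ring
      · have : Prod.mk X ⁻¹' heavy = ∅ := by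
          ext D
          simp only [hheavy, Set.mem_preimage, Set.mem_ofPred_eq, Set.mem_empty_iff_false, iff_false,
            not_and]
          exact fun h' => absurd h' hX
        rw [this]; simp
    refine (lintegral_mono hfib).trans (le_of_eq ?_)
    simp
  have hfullle : ν full ≤ ENNReal.ofReal (n * Real.exp (2 * m * Real.exp θ - θ * L)) := by
    have hcov : full ⊆ ⋃ v, {D : Destinations n m | L ≤ ({s | ∃ k, D s k = v}.ncard : ℝ)} := by
      rintro D ⟨v, hv⟩
      exact Set.mem_iUnion.2 ⟨v, hv⟩
    refine (measure_mono hcov).trans ((measure_iUnion_fintype_le _ _).trans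
      ((Finset.sum_le_card_nsmul _ _ _ fun v _ =>
        uniformOn_admissible_indegree_le hm hmn v hθ).trans (le_of_eq ?_)))
    rw [Finset.card_univ, Fintype.card_fin, nsmul_eq_mul, ← ENNReal.ofReal_natCast,
      ← ENNReal.ofReal_mul (Nat.cast_nonneg _)]
  have hlaw : networkLaw n m = (positionLaw n).prod ν := rfl
  rw [hlaw]
  refine (measure_mono hsub).trans ((measure_union_le _ _).trans (add_le_add ((measure_union_le _ _).trans
    (add_le_add ((measure_union_le _ _).trans ?_) hheavyle)) ?_))
  · refine (add_le_add_left (measure_union_le _ _) _).trans ?_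
    rw [Measure.prod_prod, Measure.prod_prod, Measure.prod_prod, hsq, hadm]
    simp only [measure_univ, mul_one, mul_zero, zero_add]
    exact positionLaw_not_balanced_le hμ
  · rw [Measure.prod_prod, measure_univ, one_mul]
    exact hfullle

/-! ### Throughput on a regular network -/

/-- The constant in the throughput bound. -/
def rateConstant (Δ B : ℝ) : ℝ :=
  1 / (2048 * ((⌈4 * (1 + Δ)⌉₊ + 2 : ℕ) : ℝ) ^ 2 * (274 + 2 * B))

theorem rateConstant_pos {Δ B : ℝ} (hB : 0 < B) : 0 < rateConstant Δ B := by
  unfold rateConstant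
  positivity

theorem feasible_of_regular {n m g h : ℕ} {μ L r Δ B : ℝ} (hm : 0 < m) (hg : 1 < g)
    (hμ : μ = n / (g : ℝ) ^ 2) (hμ4 : 4 ≤ μ) (hΔ : 0 < Δ) (hB : 0 < B) (hr : 3 / (g : ℝ) ≤ r)
    (hrg : r * g ≤ 4) (hh : (g : ℝ) ≤ √m * h) (hh' : √m * h ≤ 2 * g) (hL : L ≤ 2 * B * g)
    {ω : (Fin n → Plane) × Destinations n m} (hω : ω ∈ regularNetworks n m g h μ L) :
    Feasible ω.1 ω.2 r Δ (rateConstant Δ B * (n * r ^ 3 / √m)) := by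
  obtain ⟨hX, hD, hbal, hheavy, hdeg⟩ := hω
  set M := ⌈4 * (1 + Δ)⌉₊ + 2 with hM
  set s := √(m : ℝ) with hs
  have hg0 : (0 : ℝ) < g := by exact_mod_cast (by omega : 0 < g)
  have hg1 : (1 : ℝ) ≤ g := by exact_mod_cast hg.le
  have hm1 : (1 : ℝ) ≤ m := by exact_mod_cast hm
  have hs1 : 1 ≤ s := Real.one_le_sqrt.2 hm1
  have hss : s * s = m := Real.mul_self_sqrt (by linarith)
  have hr0 : 0 < r := lt_of_lt_of_le (by positivity) hr
  have hh0 : 0 < h := by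
    rcases Nat.eq_zero_or_pos h with h0 | h0
    · subst h0; simp at hh; linarith
    · exact h0
  have hh0' : (0 : ℝ) < h := by exact_mod_cast hh0
  have hP1 : μ / 4 ≤ (⌈μ / 4⌉₊ : ℝ) := Nat.le_ceil _
  have hP2 : (⌈μ / 4⌉₊ : ℝ) ≤ μ := by
    have := Nat.ceil_lt_add_one (show 0 ≤ μ / 4 by linarith)
    linarith
  have hP0 : 0 < ⌈μ / 4⌉₊ := Nat.ceil_pos.2 (by linarith)
  have hgh : ((g / h : ℕ) : ℝ) ≤ s := by
    refine Nat.cast_div_le.trans ?_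
    rwa [div_le_iff₀ hh0']
  set w : ℝ := (2 * g + g * ((g / h : ℕ) + 1)) * (4 * μ) + m * (128 * h * μ) with hw
  have hsg : 1 ≤ s * g := one_le_mul_of_one_le_of_one_le hs1 hg1
  have hsgμ : 1 ≤ s * g * μ := one_le_mul_of_one_le_of_one_le hsg (by linarith)
  -- Spine and teeth contribute 4·4 = 16, branches 2·128 = 256. Rounding up w and adding the
  -- injection load P ≤ μ turn 272 into the 274 of the rate constant.
  have hw1 : w ≤ 272 * (s * g * μ) := by
    have h1 : (2 * g + g * ((g / h : ℕ) + 1) : ℝ) ≤ 4 * (s * g) := by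
      have e1 : (g : ℝ) * ((g / h : ℕ) : ℝ) ≤ g * s := mul_le_mul_of_nonneg_left hgh hg0.le
      have e2 : (g : ℝ) ≤ s * g := le_mul_of_one_le_left hg0.le hs1
      linarith
    have h2 : (m * (128 * h * μ) : ℝ) ≤ 256 * (s * g * μ) := by
      rw [← hss]
      calc s * s * (128 * h * μ) = 128 * s * μ * (s * h) := by ring
        _ ≤ 128 * s * μ * (2 * g) := by gcongr
        _ = _ := by ring
    have h3 := mul_le_mul_of_nonneg_right h1 (show (0 : ℝ) ≤ 4 * μ by linarith)
    rw [hw]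
    linarith
  have hw0 : 0 ≤ w := by positivity
  have hW2 : (⌈w⌉₊ : ℝ) ≤ 273 * (s * g * μ) := by
    have := Nat.ceil_lt_add_one hw0
    linarith
  have hLfl : (⌊L⌋₊ : ℝ) ≤ 2 * B * g := by
    rcases le_total 0 L with h0 | h0
    · exact (Nat.floor_le h0).trans hL
    · rw [Nat.floor_of_nonpos h0]; simp; positivity
  have hJ : (⌈μ / 4⌉₊ + ⌈w⌉₊ + ⌊L⌋₊ * ⌈μ / 4⌉₊ : ℝ) ≤ (274 + 2 * B) * (s * g * μ) := by
    have h1 : (⌊L⌋₊ * ⌈μ / 4⌉₊ : ℝ) ≤ 2 * B * g * μ :=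
      mul_le_mul hLfl hP2 (Nat.cast_nonneg _) (by positivity)
    have h2 : 2 * B * g * μ ≤ 2 * B * (s * g * μ) := by
      calc 2 * B * g * μ ≤ s * (2 * B * g * μ) := le_mul_of_one_le_left (by positivity) hs1
        _ = _ := by ring
    have h3 : μ ≤ s * g * μ := le_mul_of_one_le_left (by linarith) hsg
    linarith
  refine feasible_of_counts (V := 128 * h * μ) (U := 4 * μ) (M := M) (g := g) (h := h)
    (P := ⌈μ / 4⌉₊) (W := ⌈w⌉₊) (L := ⌊L⌋₊) hm hX hD hP0 hg (by omega) hh0 hr ?_ ?_ ?_ ?_ ?_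
    (Nat.le_ceil w) ?_
  · have h1 := Nat.le_ceil (4 * (1 + Δ))
    rw [hM]
    push_cast
    have h2 : (1 + Δ) * (r * g) ≤ (1 + Δ) * 4 := mul_le_mul_of_nonneg_left hrg (by linarith)
    linarith
  · intro c hc
    exact Nat.ceil_le.2 (hbal c hc).1.le
  · intro c hc
    exact (hbal c hc).2.le
  · intro c hc k
    exact (hheavy c hc k).le
  · intro v
    exact Nat.le_floor (hdeg v).le
  · have hn : (n : ℝ) = μ * g ^ 2 := by rw [hμ]; field_simp
    have hM0 : (0 : ℝ) < M := by rw [hM]; positivity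
    have hrg3 : (r * g) ^ 3 ≤ 64 := by
      calc (r * g) ^ 3 ≤ 4 ^ 3 := by gcongr
        _ = 64 := by norm_num
    -- Here 2048 = 2·16·64: the factor 2 of the schedule, the 16 from P² ≥ μ²/16, and the 64 from
    -- (rg)³ ≤ 64.
    have hc : rateConstant Δ B = 1 / (2048 * (M : ℝ) ^ 2 * (274 + 2 * B)) := rfl
    calc rateConstant Δ B * (n * r ^ 3 / s) *
          (2 * (M * M * (⌈μ / 4⌉₊ + ⌈w⌉₊ + ⌊L⌋₊ * ⌈μ / 4⌉₊)))
        ≤ rateConstant Δ B * (n * r ^ 3 / s) * (2 * (M * M * ((274 + 2 * B) * (s * g * μ)))) := by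
          have := rateConstant_pos (Δ := Δ) hB
          gcongr
      _ = μ ^ 2 * (r * g) ^ 3 / 1024 := by
          rw [hc, hn]
          field_simp
          ring
      _ ≤ μ ^ 2 * 64 / 1024 := by gcongr
      _ = μ / 4 * (μ / 4) := by ring
      _ ≤ _ := by gcongr

/-! ### Passage to the limit -/

/-- Subadditivity over a set and its complement suffices, so the feasibility event need not be
measurable. -/
theorem tendsto_measure_one_of_compl {α : ℕ → Type*} [∀ n, MeasurableSpace (α n)]
    (P : ∀ n, Measure (α n)) (S : ∀ n, Set (α n)) (hP : ∀ᶠ n in atTop, IsProbabilityMeasure (P n))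
    {ε : ℕ → ENNReal} (hε : Tendsto ε atTop (𝓝 0)) (hS : ∀ᶠ n in atTop, P n (S n)ᶜ ≤ ε n) :
    Tendsto (fun n => P n (S n)) atTop (𝓝 1) := by
  have hlow : Tendsto (fun n => 1 - ε n) atTop (𝓝 1) := by
    have := ENNReal.Tendsto.sub (tendsto_const_nhds (x := (1 : ENNReal)) (f := atTop (α := ℕ))) hε
      (Or.inl ENNReal.one_ne_top)
    simpa using this
  refine tendsto_of_tendsto_of_tendsto_of_le_of_le' hlow tendsto_const_nhds ?_ ?_
  · filter_upwards [hP, hS] with n hn hSn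
    rw [tsub_le_iff_right, ← measure_univ (μ := P n)]
    exact (measure_univ_le_add_compl (S n)).trans (by gcongr)
  · filter_upwards [hP] with n hn
    exact prob_le_one

theorem tendsto_loglog_div_log (B : ℝ) :
    Tendsto (fun n : ℕ => B * (Real.log (Real.log n) / Real.log n)) atTop (𝓝 0) := by
  have h1 : Tendsto (fun x : ℝ => Real.log x / x) atTop (𝓝 0) :=
    Real.isLittleO_log_id_atTop.tendsto_div_nhds_zero
  have h2 := (h1.comp (Real.tendsto_log_atTop.comp tendsto_natCast_atTop_atTop)).const_mul B
  simpa [Function.comp_def] using h2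

/-- The probability that the network is not regular, in terms of `x = log n`. -/
theorem failure_probability_le {m h : ℕ} {n g μ x θ L : ℝ} (hh : 1 ≤ h) (hx : 0 ≤ x)
    (hn : n = Real.exp x) (hg : g ^ 2 ≤ n) (hμ : 16 * x ≤ μ) (hθ : Real.exp θ = √x)
    (hL : θ * L = 2 * x) (hmx : 4 * m ≤ √x) :
    2 * g ^ 2 * Real.exp (-μ / 4) + g ^ 2 * (m * Real.exp (-(64 * h * μ))) +
      n * Real.exp (2 * m * Real.exp θ - θ * L) ≤ (3 + m) * Real.exp (-(x / 2)) := by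
  have hh' : (1 : ℝ) ≤ h := by exact_mod_cast hh
  have hm0 : (0 : ℝ) ≤ m := Nat.cast_nonneg m
  have hsq := Real.mul_self_sqrt hx
  have hg' : g ^ 2 ≤ Real.exp x := hn ▸ hg
  have key : ∀ t, t ≤ -(4 * x) → g ^ 2 * Real.exp t ≤ Real.exp (-(x / 2)) := by
    intro t ht
    calc g ^ 2 * Real.exp t ≤ Real.exp x * Real.exp (-(4 * x)) := by gcongr
      _ = Real.exp (-(3 * x)) := by rw [← Real.exp_add]; congr 1; ring
      _ ≤ _ := Real.exp_le_exp.2 (by linarith)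
  have h1 := key (-μ / 4) (by linarith)
  have h2 := key (-(64 * h * μ)) (by nlinarith)
  have h3 : n * Real.exp (2 * m * Real.exp θ - θ * L) ≤ Real.exp (-(x / 2)) := by
    rw [hn, ← Real.exp_add, hθ, hL]
    refine Real.exp_le_exp.2 ?_
    -- Since 4m ≤ √x, the term 2m√x is at most x/2, and the exponent is at most x + x/2 - 2x.
    nlinarith [Real.sqrt_nonneg x]
  have h4 := mul_le_mul_of_nonneg_left h2 hm0
  nlinarith

end Multicast

end

theorem theorem4p9 :
    ∃ K : ℝ, 0 < K ∧ ∀ Δ B : ℝ, 0 < Δ → 0 < B →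
      ∃ c : ℝ, 0 < c ∧ ∀ m : ℕ, 1 ≤ m → ∀ T : ℕ → ℝ,
        (∀ᶠ n : ℕ in atTop, K * Real.sqrt (Real.log n / n) ≤ T n) →
        (∀ᶠ n : ℕ in atTop, T n ≤ B * (Real.log (Real.log n) / Real.log n)) →
        Tendsto (fun n : ℕ => Multicast.networkLaw n m
            {ω | Multicast.Feasible ω.1 ω.2 (T n) Δ (c * (n * T n ^ 3 / Real.sqrt m))})
          atTop (𝓝 1) := by
  -- With K = 16, nr² ≥ 256 log n, and gr ≤ 4 then gives μ ≥ 16 log n, hence exp(-μ/4) ≤ n⁻⁴ against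
  -- at most n cells.
  refine ⟨16, by norm_num, fun Δ B hΔ hB => ⟨Multicast.rateConstant Δ B,
    Multicast.rateConstant_pos hB, fun m hm T hT1 hT2 => ?_⟩⟩
  have hlog : Tendsto (fun n : ℕ => Real.log n) atTop atTop :=
    Real.tendsto_log_atTop.comp tendsto_natCast_atTop_atTop
  refine Multicast.tendsto_measure_one_of_compl _ _
    (ε := fun n => ENNReal.ofReal ((3 + m) * Real.exp (-(Real.log n / 2)))) ?_ ?_ ?_
  · filter_upwards [eventually_gt_atTop m] with n hn
    have := Multicast.isProbabilityMeasure_admissible hn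
    unfold Multicast.networkLaw
    infer_instance
  · rw [← ENNReal.ofReal_zero]
    refine ENNReal.tendsto_ofReal ?_
    have h1 : Tendsto (fun n : ℕ => Real.exp (-(Real.log n / 2))) atTop (𝓝 0) :=
      Real.tendsto_exp_neg_atTop_nhds_zero.comp (hlog.atTop_div_const (by norm_num))
    simpa using h1.const_mul (3 + m : ℝ)
  have hsm : Tendsto (fun n : ℕ => √(Real.log n)) atTop atTop :=
    Real.tendsto_sqrt_atTop.comp hlog
  -- The range tends to 0. The bound 1 keeps the rounding in g below 1/r; the bound 3/√m yields √m ≤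
  -- g, so that rounding up g/√m to h at most doubles it.
  have hmin : 0 < min (1 : ℝ) (3 / √m) := by
    have : (0 : ℝ) < m := by exact_mod_cast hm
    positivity
  filter_upwards [hT1, hT2, eventually_gt_atTop m, hlog.eventually_ge_atTop 3,
    hsm.eventually_ge_atTop (4 * m), (Multicast.tendsto_loglog_div_log B).eventually_le_const hmin]
    with n h1 h2 hmn hx hmx hsmall
  set x := Real.log n with hxdef
  set r := T n with hr
  have hn0 : (0 : ℝ) < n := by exact_mod_cast (by omega : 0 < n)
  have hm1 : (1 : ℝ) ≤ m := by exact_mod_cast hm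
  have hs1 : 1 ≤ √(m : ℝ) := Real.one_le_sqrt.2 hm1
  have hr0 : 0 < r := lt_of_lt_of_le (by positivity) h1
  have hr1 : r ≤ 1 := (h2.trans hsmall).trans (min_le_left _ _)
  have hrs : √m * r ≤ 3 := by
    have := (h2.trans hsmall).trans (min_le_right _ _)
    rwa [le_div_iff₀ (by linarith), mul_comm] at this
  have hloglog : 1 < Real.log x := by
    rw [Real.lt_log_iff_exp_lt (by linarith)]
    have := Real.exp_one_lt_d9
    linarith
  set g := ⌈3 / r⌉₊ with hg
  have hg1 : 3 / r ≤ g := Nat.le_ceil _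
  have hg2 : (g : ℝ) ≤ 4 / r := by
    have := Nat.ceil_lt_add_one (show 0 ≤ 3 / r by positivity)
    have h1r : 1 ≤ 1 / r := by rw [le_div_iff₀ hr0]; linarith
    calc (g : ℝ) ≤ 3 / r + 1 / r := by linarith
      _ = 4 / r := by ring
  have hrg3 : 3 ≤ g * r := by rwa [div_le_iff₀ hr0] at hg1
  have hrg4 : g * r ≤ 4 := by rwa [le_div_iff₀ hr0] at hg2
  have hg3 : (3 : ℝ) ≤ g := by nlinarith
  have hgone : 1 < g := by exact_mod_cast (by linarith : (1 : ℝ) < g)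
  set μ : ℝ := n / (g : ℝ) ^ 2 with hμ
  have hnr : 256 * x ≤ n * r ^ 2 := by
    have h3 : (16 * √(x / n)) ^ 2 ≤ r ^ 2 := by gcongr
    rw [mul_pow, Real.sq_sqrt (by positivity)] at h3
    calc 256 * x = n * (16 ^ 2 * (x / n)) := by field_simp; norm_num
      _ ≤ n * r ^ 2 := by gcongr
  have hμx : 16 * x ≤ μ := by
    rw [hμ, le_div_iff₀ (by positivity)]
    have h4 : (g * r) ^ 2 ≤ 16 := by nlinarith
    have h5 : n * (g * r) ^ 2 ≤ n * 16 := by gcongr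
    have h6 : 256 * x * (g : ℝ) ^ 2 ≤ n * r ^ 2 * (g : ℝ) ^ 2 := by gcongr
    nlinarith
  have hgn : (g : ℝ) ^ 2 ≤ n := by
    have : 1 ≤ μ := by linarith
    rwa [hμ, le_div_iff₀ (by positivity), one_mul] at this
  set h := ⌈(g : ℝ) / √m⌉₊ with hh
  have hh1 : (g : ℝ) ≤ √m * h := by
    have := Nat.le_ceil ((g : ℝ) / √m)
    rwa [div_le_iff₀ (by linarith), mul_comm] at this
  have hh2 : √m * h ≤ 2 * g := by
    have h3 := Nat.ceil_lt_add_one (show 0 ≤ (g : ℝ) / √m by positivity)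
    have h4 : √m * h ≤ √m * (g / √m + 1) := by gcongr
    have h5 : √m * (g / √m + 1) = g + √m := by field_simp
    have h6 : √(m : ℝ) ≤ g := by nlinarith
    linarith
  have hh0 : 1 ≤ h := Nat.one_le_ceil_iff.2 (by positivity)
  -- Paired with θ = (log x)/2, so that exp θ = √x and θL = 2x. The upper bound on the range is used
  -- to get L = O(g).
  set L : ℝ := 4 * (x / Real.log x) with hL
  have hLB : L ≤ 2 * B * g := by
    have h3 : r * (x / Real.log x) ≤ B := by
      calc r * (x / Real.log x) ≤ B * (Real.log x / x) * (x / Real.log x) := by gcongr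
        _ = B := by field_simp
    have h4 : x / Real.log x ≤ B / r := by rw [le_div_iff₀ hr0, mul_comm]; exact h3
    have h5 : B / r ≤ B * g / 3 := by
      rw [div_le_iff₀ hr0]
      nlinarith
    have h6 : 0 ≤ B * g := by positivity
    linarith
  have hθ : 0 < Real.log x / 2 := by linarith
  refine (measure_mono (Set.compl_subset_compl.2 fun ω hω =>
    Multicast.feasible_of_regular hm hgone hμ (by linarith) hΔ hB ?_ (by linarith) hh1 hh2 hLB
      hω)).trans ((Multicast.networkLaw_regular_compl_le hm hmn (by omega) hμ hθ).trans ?_)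
  · rw [div_le_iff₀ (by linarith)]; linarith
  · rw [← ENNReal.ofReal_add (by positivity) (by positivity),
      ← ENNReal.ofReal_add (by positivity) (by positivity)]
    refine ENNReal.ofReal_le_ofReal (Multicast.failure_probability_le hh0 (by linarith)
      (Real.exp_log hn0).symm hgn hμx ?_ ?_ hmx)
    · rw [Real.sqrt_eq_rpow, Real.rpow_def_of_pos (by linarith)]
      congr 1; ring
    · rw [hL]
      field_simp
      ring
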